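/- Let $A$ be a separable quasidiagonal $C^*$-algebra (not necessarily unital), i.e. $A$ has a faithful representation on a Hilbert space whose image is a quasidiagonal set of operators. Let $K_0^+(A)\subset K_0(A)$ be the set of classes $[p]$ of projections $p\in M_n(A)$, $n\in\mathbb N$. Consider sequences of contractive completely positive (ccp) maps $\phi_n : A\to M_{k_n}(\mathbb C)$ that are asymptotically multiplicative and asymptotically isometric, i.e. $\|\phi_n(ab)-\phi_n(a)\phi_n(b)\|\to 0$ and $\|\phi_n(a)\|\to\|a\|$ for all $a,b\in A$. For such a sequence and $x=[p]-[q]\in K_0(A)$, with $p,q$ projections in matrices over the unitization $A^+$, let $(\phi_n)_*(x)\in K_0(M_{k_n}(\mathbb C))=\mathbb Z$ be the difference of the ranks of the spectral projections for $(1/2,\infty)$ of the images of $p$ and $q$ under the (amplified) unital extension of $\phi_n$ to $A^+$; for all large $n$ this does not depend on the choice of $p,q$. Then the following two properties are equivalent. (1) ($K_0$-Hahn-Banach property) For each $x\in K_0(A)$ with $\mathbb Zx\cap K_0^+(A)=\{0\}$ there is an asymptotically multiplicative, asymptotically isometric sequence of ccp maps $\phi_n:A\to M_{k_n}(\mathbb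 C)$ such that $(\phi_n)_*(x)=0$ for all large $n$. (2) If $x\in K_0(A)$ and for every asymptotically multiplicative, asymptotically isometric sequence of ccp maps $\phi_n:A\to M_{k_n}(\mathbb C)$ we have $(\phi_n)_*(x)>0$ for all large $n$, then there is a positive integer $k$ such that $kx\in K_0^+(A)$. -/

import Mathlib

open Filter Topology Matrix
open scoped CStarAlgebra ComplexOrder

/-! ### Projections in matrix algebras and the Murray-von Neumann semigroup -/

section MurrayVonNeumann

/-- The projections of all matrix algebras `Mₙ(R)`, `n : ℕ`, over a (possibly non-unital)
`*`-ring `R`. -/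
def MatProj (R : Type*) [NonUnitalRing R] [StarRing R] : Type _ :=
  Σ n : ℕ, {p : Matrix (Fin n) (Fin n) R // IsStarProjection p}

/-- Murray-von Neumann equivalence of square matrices, possibly of different sizes:
`p = v v*` and `q = v* v` for some rectangular matrix `v`. -/
def MvN {R : Type*} [NonUnitalRing R] [StarRing R] {m n : Type*} [Fintype m] [Fintype n]
    (p : Matrix m m R) (q : Matrix n n R) : Prop :=
  ∃ v : Matrix m n R, v * vᴴ = p ∧ vᴴ * v = q

variable {R S : Type*} [NonUnitalRing R] [StarRing R] [NonUnitalRing S] [StarRing S]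
variable {l m n m' n' : Type*} [Fintype l] [Fintype m] [Fintype n] [Fintype m'] [Fintype n']

theorem IsStarProjection.mat_mul {p : Matrix m m R} (hp : IsStarProjection p) : p * p = p :=
  hp.isIdempotentElem

theorem IsStarProjection.mat_star {p : Matrix m m R} (hp : IsStarProjection p) : pᴴ = p :=
  hp.isSelfAdjoint

theorem MvN.rfl {p : Matrix m m R} (hp : IsStarProjection p) : MvN p p :=
  ⟨p, by rw [hp.mat_star, hp.mat_mul], by rw [hp.mat_star, hp.mat_mul]⟩

theorem MvN.symm {p : Matrix m m R} {q : Matrix n n R} : MvN p q → MvN q p := by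
  rintro ⟨v, h1, h2⟩
  exact ⟨vᴴ, by rw [conjTranspose_conjTranspose, h2], by rw [conjTranspose_conjTranspose, h1]⟩

theorem MvN.trans {p : Matrix l l R} {q : Matrix m m R} {r : Matrix n n R}
    (hp : IsStarProjection p) (hr : IsStarProjection r) : MvN p q → MvN q r → MvN p r := by
  rintro ⟨v, h1, h2⟩ ⟨w, h3, h4⟩
  refine ⟨v * w, ?_, ?_⟩
  · calc v * w * (v * w)ᴴ = v * (w * wᴴ) * vᴴ := by
          rw [conjTranspose_mul]; simp only [Matrix.mul_assoc]
      _ = (v * vᴴ) * (v * vᴴ) := by rw [h3, ← h2]; simp only [Matrix.mul_assoc]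
      _ = p := by rw [h1, hp.mat_mul]
  · calc (v * w)ᴴ * (v * w) = wᴴ * (vᴴ * v) * w := by
          rw [conjTranspose_mul]; simp only [Matrix.mul_assoc]
      _ = (wᴴ * w) * (wᴴ * w) := by rw [h2, ← h3]; simp only [Matrix.mul_assoc]
      _ = r := by rw [h4, hr.mat_mul]

/-- The block diagonal sum of two matrices. -/
def dsum (p : Matrix m m R) (q : Matrix n n R) : Matrix (m ⊕ n) (m ⊕ n) R :=
  fromBlocks p 0 0 q

theorem IsStarProjection.dsum {p : Matrix m m R} {q : Matrix n n R}
    (hp : IsStarProjection p) (hq : IsStarProjection q) : IsStarProjection (dsum p q) := by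
  refine ⟨?_, ?_⟩
  · simp [IsIdempotentElem, _root_.dsum, fromBlocks_multiply, hp.mat_mul, hq.mat_mul]
  · simp [IsSelfAdjoint, star_eq_conjTranspose, _root_.dsum, fromBlocks_conjTranspose,
      hp.mat_star, hq.mat_star]

theorem IsStarProjection.submatrix {p : Matrix m m R} (hp : IsStarProjection p) (e : n ≃ m) :
    IsStarProjection (p.submatrix e e) := by
  refine ⟨?_, ?_⟩
  · rw [IsIdempotentElem, submatrix_mul_equiv, hp.mat_mul]
  · rw [IsSelfAdjoint, star_eq_conjTranspose, conjTranspose_submatrix, hp.mat_star]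

theorem MvN.submatrix {p : Matrix m m R} (hp : IsStarProjection p) (e : n ≃ m) :
    MvN (p.submatrix e e) p := by
  refine ⟨p.submatrix e id, ?_, ?_⟩
  · rw [conjTranspose_submatrix, hp.mat_star]
    ext i j
    have := congrFun (congrFun hp.mat_mul (e i)) (e j)
    simpa [Matrix.mul_apply] using this
  · rw [conjTranspose_submatrix, hp.mat_star, submatrix_mul_equiv, hp.mat_mul, submatrix_id_id]

theorem MvN.dsum {p : Matrix m m R} {q : Matrix n n R} {p' : Matrix m' m' R}
    {q' : Matrix n' n' R} : MvN p p' → MvN q q' → MvN (dsum p q) (dsum p' q') := by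
  rintro ⟨v, h1, h2⟩ ⟨w, h3, h4⟩
  refine ⟨fromBlocks v 0 0 w, ?_, ?_⟩ <;>
    simp [_root_.dsum, fromBlocks_conjTranspose, fromBlocks_multiply, *]

theorem mvn_dsum_comm {p : Matrix m m R} {q : Matrix n n R}
    (hp : IsStarProjection p) (hq : IsStarProjection q) : MvN (dsum p q) (dsum q p) := by
  refine ⟨fromBlocks 0 p q 0, ?_, ?_⟩ <;>
    simp [_root_.dsum, fromBlocks_conjTranspose, fromBlocks_multiply, hp.mat_mul, hq.mat_mul,
      hp.mat_star, hq.mat_star]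

set_option linter.unusedSectionVars false in
theorem dsum_assoc_submatrix (p : Matrix l l R) (q : Matrix m m R) (r : Matrix n n R) :
    (dsum p (dsum q r)).submatrix (Equiv.sumAssoc l m n) (Equiv.sumAssoc l m n)
      = dsum (dsum p q) r := by
  ext i j
  rcases i with (i | i) | i <;> rcases j with (j | j) | j <;> simp [dsum]

set_option linter.unusedSectionVars false in
theorem dsum_zero_submatrix (p : Matrix m m R) (q : Matrix (Fin 0) (Fin 0) R) :
    p.submatrix (Equiv.sumEmpty m (Fin 0)) (Equiv.sumEmpty m (Fin 0)) = dsum p q := by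
  ext i j
  rcases i with i | i
  · rcases j with j | j
    · simp [dsum]
    · exact j.elim0
  · exact i.elim0

theorem MvN.map {p : Matrix m m R} {q : Matrix n n R} (f : R →⋆ₙ+* S) :
    MvN p q → MvN (p.map f) (q.map f) := by
  rintro ⟨v, rfl, rfl⟩
  refine ⟨v.map f, ?_, ?_⟩
  · ext i j; simp [Matrix.mul_apply, map_sum, map_star]
  · ext i j; simp [Matrix.mul_apply, map_sum, map_star]

theorem IsStarProjection.matMap {p : Matrix m m R} (hp : IsStarProjection p) (f : R →⋆ₙ+* S) :
    IsStarProjection (p.map f) := by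
  refine ⟨?_, ?_⟩
  · ext i j
    conv_rhs => rw [← hp.mat_mul]
    simp [Matrix.mul_apply, map_sum]
  · ext i j
    have := congrFun (congrFun hp.mat_star i) j
    simp only [conjTranspose_apply] at this
    simp [star_apply, ← map_star, this]

namespace MatProj

/-- Murray-von Neumann equivalence of projections in matrix algebras. -/
instance setoid (R : Type*) [NonUnitalRing R] [StarRing R] : Setoid (MatProj R) where
  r p q := MvN p.2.1 q.2.1
  iseqv := ⟨fun p => MvN.rfl p.2.2, MvN.symm, fun {p _ r} h h' => MvN.trans p.2.2 r.2.2 h h'⟩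

/-- The block diagonal sum `p ⊕ q`, a projection in `Mₘ₊ₙ(R)`. -/
def add (p q : MatProj R) : MatProj R :=
  ⟨p.1 + q.1, (dsum p.2.1 q.2.1).submatrix finSumFinEquiv.symm finSumFinEquiv.symm,
    (p.2.2.dsum q.2.2).submatrix _⟩

/-- The image of a projection under the amplification of a `*`-homomorphism. -/
def map (f : R →⋆ₙ+* S) (p : MatProj R) : MatProj S :=
  ⟨p.1, p.2.1.map f, p.2.2.matMap f⟩

theorem add_mvn (p q : MatProj R) : MvN (add p q).2.1 (dsum p.2.1 q.2.1) :=
  MvN.submatrix (p.2.2.dsum q.2.2) _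

theorem equiv_of_mvn {p q : MatProj R} {r : Matrix m m R} {s : Matrix n n R}
    (_hr : IsStarProjection r) (hs : IsStarProjection s)
    (h : MvN p.2.1 r) (h' : MvN r s) (h'' : MvN s q.2.1) : p ≈ q :=
  MvN.trans p.2.2 q.2.2 (MvN.trans p.2.2 hs h h') h''

end MatProj

/-- The Murray-von Neumann semigroup `V(R)`: equivalence classes of projections in matrices
over `R`. -/
def MvNSemigroup (R : Type*) [NonUnitalRing R] [StarRing R] : Type _ :=
  Quotient (MatProj.setoid R)

namespace MvNSemigroup

/-- The class of a projection. -/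
def mk (p : MatProj R) : MvNSemigroup R := Quotient.mk _ p

/-- Addition is induced by block diagonal sums. -/
instance : Add (MvNSemigroup R) where
  add := Quotient.map₂ MatProj.add fun p p' h q q' h' =>
    MatProj.equiv_of_mvn (p.2.2.dsum q.2.2) (p'.2.2.dsum q'.2.2) (MatProj.add_mvn p q)
      (MvN.dsum h h') (MatProj.add_mvn p' q').symm

/-- The zero is the class of the `0 × 0` matrix, which is also the class of any zero matrix. -/
instance : Zero (MvNSemigroup R) where
  zero := mk ⟨0, 0, IsStarProjection.zero _⟩

instance : AddCommMonoid (MvNSemigroup R) where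
  nsmul := nsmulRec
  add_assoc := by
    rintro ⟨p⟩ ⟨q⟩ ⟨r⟩
    refine Quotient.sound (MatProj.equiv_of_mvn ((p.2.2.dsum q.2.2).dsum r.2.2)
      (p.2.2.dsum (q.2.2.dsum r.2.2)) ?_ ?_ ?_)
    · exact MvN.trans (MatProj.add _ _).2.2 ((p.2.2.dsum q.2.2).dsum r.2.2)
        (MatProj.add_mvn (MatProj.add p q) r) (MvN.dsum (MatProj.add_mvn p q) (MvN.rfl r.2.2))
    · rw [← dsum_assoc_submatrix]
      exact MvN.submatrix (p.2.2.dsum (q.2.2.dsum r.2.2)) _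
    · exact (MvN.trans (MatProj.add _ _).2.2 (p.2.2.dsum (q.2.2.dsum r.2.2))
        (MatProj.add_mvn p (MatProj.add q r))
        (MvN.dsum (MvN.rfl p.2.2) (MatProj.add_mvn q r))).symm
  zero_add := by
    rintro ⟨p⟩
    refine Quotient.sound (MatProj.equiv_of_mvn
      ((IsStarProjection.zero (Matrix (Fin 0) (Fin 0) R)).dsum p.2.2)
      (p.2.2.dsum (IsStarProjection.zero (Matrix (Fin 0) (Fin 0) R)))
      (MatProj.add_mvn _ p) (mvn_dsum_comm (IsStarProjection.zero _) p.2.2) ?_)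
    rw [← dsum_zero_submatrix]
    exact MvN.submatrix p.2.2 _
  add_zero := by
    rintro ⟨p⟩
    refine Quotient.sound (MatProj.equiv_of_mvn
      (p.2.2.dsum (IsStarProjection.zero (Matrix (Fin 0) (Fin 0) R))) p.2.2
      (MatProj.add_mvn p _) ?_ (MvN.rfl p.2.2))
    rw [← dsum_zero_submatrix]
    exact MvN.submatrix p.2.2 _
  add_comm := by
    rintro ⟨p⟩ ⟨q⟩
    exact Quotient.sound (MatProj.equiv_of_mvn (p.2.2.dsum q.2.2) (q.2.2.dsum p.2.2)
      (MatProj.add_mvn p q) (mvn_dsum_comm p.2.2 q.2.2) (MatProj.add_mvn q p).symm)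

/-- Functoriality of `V` for `*`-homomorphisms. -/
def map (f : R →⋆ₙ+* S) : MvNSemigroup R →+ MvNSemigroup S where
  toFun := Quotient.map (MatProj.map f) fun _ _ h => MvN.map f h
  map_zero' := Quotient.sound (by
    change MvN (Matrix.map (0 : Matrix (Fin 0) (Fin 0) R) f) (0 : Matrix (Fin 0) (Fin 0) S)
    exact ⟨0, Subsingleton.elim _ _, Subsingleton.elim _ _⟩)
  map_add' := by
    rintro ⟨p⟩ ⟨q⟩
    suffices key : MatProj.map f (MatProj.add p q)
        = MatProj.add (MatProj.map f p) (MatProj.map f q) from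
      congrArg (Quotient.mk _) key
    refine congrArg (Sigma.mk (p.1 + q.1)) (Subtype.ext ?_)
    change ((dsum p.2.1 q.2.1).submatrix finSumFinEquiv.symm finSumFinEquiv.symm).map f
      = (dsum (p.2.1.map f) (q.2.1.map f)).submatrix finSumFinEquiv.symm finSumFinEquiv.symm
    rw [dsum, dsum, ← Matrix.submatrix_map, Matrix.fromBlocks_map]
    simp [Matrix.map_zero]

end MvNSemigroup

end MurrayVonNeumann

/-! ### `K₀` -/

section KZero

/-- The Grothendieck group of `V(R)`.  For a unital C*-algebra `R` this is `K₀(R)`. -/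
abbrev GrothendieckV (R : Type*) [NonUnitalRing R] [StarRing R] : Type _ :=
  Algebra.GrothendieckAddGroup (MvNSemigroup R)

/-- The class `[p]` of a projection `p` in the Grothendieck group of `V(R)`. -/
noncomputable def projClass {R : Type*} [NonUnitalRing R] [StarRing R] (p : MatProj R) :
    GrothendieckV R :=
  Algebra.GrothendieckAddGroup.of (MvNSemigroup.mk p)

/-- Functoriality of the Grothendieck group of `V`. -/
noncomputable def GrothendieckV.map {R S : Type*} [NonUnitalRing R] [StarRing R]
    [NonUnitalRing S] [StarRing S] (f : R →⋆ₙ+* S) : GrothendieckV R →+ GrothendieckV S :=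
  Algebra.GrothendieckAddGroup.lift (Algebra.GrothendieckAddGroup.of.comp (MvNSemigroup.map f))

theorem exists_projClass_sub {R : Type*} [NonUnitalRing R] [StarRing R] (x : GrothendieckV R) :
    ∃ pq : MatProj R × MatProj R, x = projClass pq.1 - projClass pq.2 := by
  induction x using AddLocalization.ind with
  | H y =>
    obtain ⟨a, b, hb⟩ := y
    obtain ⟨p, rfl⟩ := Quotient.exists_rep a
    obtain ⟨q, rfl⟩ := Quotient.exists_rep b
    refine ⟨(p, q), ?_⟩
    change AddLocalization.mk _ _ = AddLocalization.mk _ _ - AddLocalization.mk _ _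
    rw [Algebra.GrothendieckAddGroup.mk_sub_mk]
    congr 1
    · exact (add_zero _).symm
    · exact Subtype.ext (zero_add _).symm

variable (A : Type*) [NonUnitalCStarAlgebra A]

/-- The canonical character `A⁺ → ℂ`, `(c, a) ↦ c`, of the unitization `A⁺ = ℂ ⊕ A`. -/
def unitizationScalar : Unitization ℂ A →⋆ₙ+* ℂ where
  toFun z := z.fst
  map_mul' := Unitization.fst_mul
  map_zero' := Unitization.fst_zero
  map_add' := Unitization.fst_add
  map_star' := Unitization.fst_star

/-- The canonical embedding `A → A⁺` into the unitization. -/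
def unitizationInr : A →⋆ₙ+* Unitization ℂ A where
  toFun a := (a : Unitization ℂ A)
  map_mul' := Unitization.inr_mul ℂ
  map_zero' := Unitization.inr_zero ℂ
  map_add' := Unitization.inr_add ℂ
  map_star' := Unitization.inr_star

/-- `K₀(A)` of a (unital or non-unital) C*-algebra: the kernel of `K₀(A⁺) → K₀(ℂ)`, where `A⁺` is
the unitization, with a new unit adjoined also when `A` is unital. -/
noncomputable def K0 : AddSubgroup (GrothendieckV (Unitization ℂ A)) :=
  (GrothendieckV.map (unitizationScalar A)).ker

/-- The positive cone `K₀⁺(A) ⊆ K₀(A)`: the classes `[p]` of projections `p ∈ Mₙ(A)`, `n : ℕ`. -/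
def K0Pos : Set (K0 A) :=
  {x | ∃ p : MatProj A, (x : GrothendieckV (Unitization ℂ A))
    = projClass (p.map (unitizationInr A))}

end KZero

/-! ### Quasidiagonality and finite dimensional approximate morphisms -/

section Quasidiagonal

universe u

/-- A set `Ω` of operators on a Hilbert space is quasidiagonal if for all finite sets of operators
in `Ω` and of vectors there are finite rank projections which almost commute with the operators
and almost fix the vectors. -/
def IsQuasidiagonalSet {H : Type*} [NormedAddCommGroup H] [InnerProductSpace ℂ H]
    [CompleteSpace H] (Ω : Set (H →L[ℂ] H)) : Prop :=
  ∀ F : Finset (H →L[ℂ] H), (F : Set (H →L[ℂ] H)) ⊆ Ω → ∀ X : Finset H, ∀ ε : ℝ, 0 < ε →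
    ∃ P : H →L[ℂ] H, IsStarProjection P ∧ FiniteDimensional ℂ (LinearMap.range P.toLinearMap) ∧
      (∀ T ∈ F, ‖P * T - T * P‖ ≤ ε) ∧ ∀ v ∈ X, ‖P v - v‖ ≤ ε

/-- A C*-algebra is quasidiagonal (QD) if it has a faithful representation on a Hilbert space whose
image is a quasidiagonal set of operators. -/
def IsQuasidiagonal (A : Type u) [NonUnitalCStarAlgebra A] : Prop :=
  ∃ (H : Type u) (_ : NormedAddCommGroup H) (_ : InnerProductSpace ℂ H) (_ : CompleteSpace H)
    (π : A →⋆ₙₐ[ℂ] (H →L[ℂ] H)), Function.Injective π ∧ IsQuasidiagonalSet (Set.range π)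

/-- An asymptotically multiplicative, asymptotically isometric sequence of contractive completely
positive (ccp) maps `φₙ : A → M_{kₙ}(ℂ)`.  Here `CStarMatrix (Fin k) (Fin k) ℂ` is `Mₖ(ℂ)` with its
C*-norm. -/
structure CcpApprox (A : Type*) [NonUnitalCStarAlgebra A] [PartialOrder A]
    [StarOrderedRing A] where
  k : ℕ → ℕ
  φ : ∀ n, A →CP CStarMatrix (Fin (k n)) (Fin (k n)) ℂ
  contractive : ∀ n a, ‖φ n a‖ ≤ ‖a‖
  asymp_mul : ∀ a b, Tendsto (fun n => ‖φ n (a * b) - φ n a * φ n b‖) atTop (𝓝 0)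
  asymp_isometric : ∀ a, Tendsto (fun n => ‖φ n a‖) atTop (𝓝 ‖a‖)

variable {A : Type*} [NonUnitalCStarAlgebra A] [PartialOrder A] [StarOrderedRing A]

/-- The unital extension `(c, a) ↦ c 1 + φ(a)` to the unitization, applied to all entries of a matrix
`p ∈ Mₘ(A⁺)`; the result lies in `Mₘ(Mₖ(ℂ)) = Mₘₖ(ℂ)`. -/
noncomputable def amplify {k m : ℕ} (φ : A →CP CStarMatrix (Fin k) (Fin k) ℂ)
    (p : Matrix (Fin m) (Fin m) (Unitization ℂ A)) :
    Matrix (Fin m × Fin k) (Fin m × Fin k) ℂ :=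
  Matrix.of fun i j =>
    ((p i.1 j.1).fst • (1 : CStarMatrix (Fin k) (Fin k) ℂ) + φ (p i.1 j.1).snd) i.2 j.2

/-- The rank of the spectral projection of a Hermitian matrix for the interval `(1/2, ∞)`. -/
noncomputable def spectralRank {ι : Type*} [Fintype ι] [DecidableEq ι] (M : Matrix ι ι ℂ) : ℕ :=
  (cfc (fun t : ℝ => if 1 / 2 < t then (1 : ℝ) else 0) M).rank

/-- The class `φ_*([p]) ∈ K₀(Mₖ(ℂ)) = ℤ` of a projection `p` over `A⁺`: if `φ` is sufficiently
multiplicative, then the image of `p` is close to a projection, namely to its spectral projection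
for `(1/2, ∞)`, and `φ_*([p])` is the rank of the latter. -/
noncomputable def projRank {k : ℕ} (φ : A →CP CStarMatrix (Fin k) (Fin k) ℂ)
    (p : MatProj (Unitization ℂ A)) : ℤ :=
  spectralRank (amplify φ p.2.1)

/-- The sequence `(φₙ)_*(x) ∈ K₀(M_{kₙ}(ℂ)) = ℤ` for `x ∈ K₀(A)`: write `x = [p] - [q]` and take the
difference of the ranks of `(φₙ)_*([p])` and `(φₙ)_*([q])`.  Two choices of `p, q` (here a fixed
choice for each `x` is made) lead to sequences that agree for all large `n`; only the behaviour
for large `n` is meaningful. -/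
noncomputable def CcpApprox.pushforward (Φ : CcpApprox A) (x : K0 A) (n : ℕ) : ℤ :=
  projRank (Φ.φ n) (exists_projClass_sub x.1).choose.1
    - projRank (Φ.φ n) (exists_projClass_sub x.1).choose.2

variable (A) in
/-- The `K₀`-Hahn-Banach property: if `ℤx ∩ K₀⁺(A) = {0}`, then some asymptotically multiplicative,
asymptotically isometric sequence of ccp maps into matrices has `(φₙ)_*(x) = 0` for all
large `n`. -/
def HasK0HahnBanach : Prop :=
  ∀ x : K0 A, (AddSubgroup.zmultiples x : Set (K0 A)) ∩ K0Pos A = {0} →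
    ∃ Φ : CcpApprox A, ∀ᶠ n in atTop, Φ.pushforward x n = 0

end Quasidiagonal

/-! ### Ranks of spectral projections -/

section SpectralRank

open scoped Matrix.Norms.L2Operator

variable {m n : Type*} [Fintype m] [DecidableEq m] [Fintype n] [DecidableEq n]

/-! Each sequence `Φ` induces a homomorphism from `K₀(A)` to integer sequences modulo eventual
equality, and it sends `K0Pos A` to eventually nonnegative sequences. This rests on stability of
spectral ranks: approximately equivalent approximate projections have equal rank
(`spectralRank_eq_of_approx_mvn`). Quasidiagonality and separability provide at least one such
sequence, by compressing to finite rank projections (`nonempty_ccpApprox`).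

(1) ⇒ (2): let `x` be eventually positive under every sequence, with no positive multiple in the
cone. A negative multiple in the cone would be eventually nonnegative and eventually negative under
an existing sequence. So `ℤx` meets the cone only in `0`, and the Hahn-Banach property gives a
sequence killing `x`, a contradiction.

(2) ⇒ (1): every sequence kills a torsion element. If `x` is not torsion, no positive multiple of
`x` or `-x` lies in the cone, so (2) fails to apply to either. Hence some `Φ` is `≤ 0` on `x`
infinitely often and some `Ψ` is `≥ 0` infinitely often. Along subsequences either a value is `0`,
or the values are `a < 0 < b`; then `b` copies of `Φₛ` plus `|a|` copies of `Ψₛ` give exactly `0`.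
Block sums take maxima of norms and of multiplicativity defects, so even unbounded multiplicities
cost nothing (`CcpApprox.exists_pushforward_eq_zero`). -/

/-- In terms of the characteristic polynomial, invariance under reindexing and additivity on block
sums become immediate. -/
theorem spectralRank_eq_card_roots {M : Matrix n n ℂ} (hM : M.IsHermitian) :
    spectralRank M = (M.charpoly.roots.filter fun z : ℂ => 1 / 2 < z.re).card := by
  have h1 : spectralRank M = Fintype.card {i // 1 / 2 < hM.eigenvalues i} := by
    rw [spectralRank, hM.cfc_eq, IsHermitian.cfc, Unitary.conjStarAlgAut_apply,
      Matrix.rank_mul_eq_left_of_isUnit_det, Matrix.rank_mul_eq_right_of_isUnit_det,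
      Matrix.rank_diagonal]
    · exact Fintype.card_congr (Equiv.subtypeEquivRight fun i => by simp)
    · exact (Matrix.isUnit_iff_isUnit_det _).1 (Unitary.toUnits hM.eigenvectorUnitary).isUnit
    · exact (Matrix.isUnit_iff_isUnit_det _).1 (Unitary.toUnits (star hM.eigenvectorUnitary)).isUnit
  rw [h1, hM.roots_charpoly_eq_eigenvalues, Multiset.filter_map, Multiset.card_map,
    Fintype.card_subtype]
  simp [Finset.card_def, Finset.filter_val, Function.comp_def]

theorem spectralRank_submatrix {M : Matrix n n ℂ} (hM : M.IsHermitian) (e : m ≃ n) :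
    spectralRank (M.submatrix e e) = spectralRank M := by
  rw [spectralRank_eq_card_roots hM, spectralRank_eq_card_roots (hM.submatrix e)]
  have : (M.submatrix e e).charpoly = M.charpoly := Matrix.charpoly_reindex e.symm M
  rw [this]

theorem spectralRank_fromBlocks {M : Matrix m m ℂ} {N : Matrix n n ℂ} (hM : M.IsHermitian)
    (hN : N.IsHermitian) :
    spectralRank (fromBlocks M 0 0 N) = spectralRank M + spectralRank N := by
  rw [spectralRank_eq_card_roots hM, spectralRank_eq_card_roots hN,
    spectralRank_eq_card_roots (hM.fromBlocks (by simp) hN), charpoly_fromBlocks_zero₁₂,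
    Polynomial.roots_mul (mul_ne_zero M.charpoly_monic.ne_zero N.charpoly_monic.ne_zero),
    Multiset.filter_add, Multiset.card_add]

/-- The invertible matrix `1 - (P - X) P` carries `P` to `X P`. -/
theorem rank_le_rank_of_norm_sub_lt_one {P X : Matrix n n ℂ} (hP : IsStarProjection P)
    (h : ‖P - X‖ < 1) : P.rank ≤ X.rank := by
  have hU : IsUnit (1 - (P - X) * P) := by
    refine isUnit_one_sub_of_norm_lt_one ?_
    calc ‖(P - X) * P‖ ≤ ‖P - X‖ * ‖P‖ := norm_mul_le _ _
      _ ≤ ‖P - X‖ * 1 := by gcongr; exact hP.norm_le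
      _ < 1 := by simpa using h
  have hPP : P * P = P := hP.isIdempotentElem
  have key : (1 - (P - X) * P) * P = X * P := by
    rw [sub_mul, sub_mul, sub_mul, one_mul, hPP, hPP, mul_assoc X, hPP]; abel
  calc P.rank = ((1 - (P - X) * P) * P).rank :=
        (Matrix.rank_mul_eq_right_of_isUnit_det _ _ ((Matrix.isUnit_iff_isUnit_det _).1 hU)).symm
    _ = (X * P).rank := by rw [key]
    _ ≤ X.rank := Matrix.rank_mul_le_left _ _

/-- The spectral projection of a Hermitian matrix for the interval `(1/2, ∞)`. -/
noncomputable def spectralProj (M : Matrix n n ℂ) : Matrix n n ℂ :=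
  cfc (fun t : ℝ => if 1 / 2 < t then (1 : ℝ) else 0) M

/-- The spectrum is finite, so the step function is admissible in the continuous functional
calculus. -/
theorem continuousOn_spectrum (f : ℝ → ℝ) (M : Matrix n n ℂ) :
    ContinuousOn f (spectrum ℝ M) := by
  rw [continuousOn_iff_continuous_domRestrict]
  exact continuous_of_discreteTopology

theorem isStarProjection_spectralProj (M : Matrix n n ℂ) : IsStarProjection (spectralProj M) := by
  refine ⟨?_, cfc_predicate _ M⟩
  rw [IsIdempotentElem, spectralProj, ← cfc_mul _ _ M (continuousOn_spectrum _ _)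
    (continuousOn_spectrum _ _)]
  congr 1
  ext t
  split_ifs <;> simp

/-- By functional calculus this is a scalar inequality: `|t² - t|` is the product of the distances
from `t` to `0` and to `1`, and the distance to the endpoint not chosen by the cutoff is at least
`1/2`. -/
theorem norm_spectralProj_sub_le {M : Matrix n n ℂ} (hM : M.IsHermitian) :
    ‖spectralProj M - M‖ ≤ 2 * ‖M * M - M‖ := by
  have hM' : IsSelfAdjoint M := hM
  set f : ℝ → ℝ := fun t => if 1 / 2 < t then (1 : ℝ) else 0
  have e1 : spectralProj M - M = cfc (fun t => f t - t) M := by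
    rw [cfc_sub f (fun t => t) M (continuousOn_spectrum _ _) (continuousOn_spectrum _ _),
      cfc_id' ℝ M]
    rfl
  have e2 : M * M - M = cfc (fun t : ℝ => t * t - t) M := by
    rw [cfc_sub (fun t : ℝ => t * t) (fun t => t) M (continuousOn_spectrum _ _)
      (continuousOn_spectrum _ _), cfc_mul (fun t : ℝ => t) (fun t => t) M
      (continuousOn_spectrum _ _) (continuousOn_spectrum _ _), cfc_id' ℝ M]
  rw [e1]
  refine norm_cfc_le (by positivity) fun t ht => ?_
  have h := norm_apply_le_norm_cfc (fun t : ℝ => t * t - t) M ht (continuousOn_spectrum _ _)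
  rw [← e2] at h
  refine le_trans ?_ (mul_le_mul_of_nonneg_left h zero_le_two)
  simp only [Real.norm_eq_abs, f]
  rw [show t * t - t = t * (t - 1) by ring, abs_mul]
  split_ifs with h2
  · rw [abs_of_pos (by linarith : 0 < t), abs_sub_comm]
    nlinarith [abs_nonneg (t - 1)]
  · rw [abs_of_nonpos (by linarith : t - 1 ≤ 0), zero_sub, abs_neg]
    nlinarith [abs_nonneg t]

/-- It suffices that `V Q Vᴴ`, whose rank is at most that of `Q`, lies within distance `1` of `P`.
-/
theorem spectralRank_le_of_approx_mvn {M : Matrix m m ℂ} {N : Matrix n n ℂ} (hM : M.IsHermitian)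
    (hN : N.IsHermitian) (V : Matrix m n ℂ) {C δ : ℝ} (hC : ‖V‖ ≤ C) (hδ : δ ≤ 1)
    (hδ' : δ * (5 * C ^ 2 + 4) < 1) (hMM : ‖M * M - M‖ ≤ δ) (hNN : ‖N * N - N‖ ≤ δ)
    (hVM : ‖V * Vᴴ - M‖ ≤ δ) (hVN : ‖Vᴴ * V - N‖ ≤ δ) :
    spectralRank M ≤ spectralRank N := by
  set P := spectralProj M
  set Q := spectralProj N
  have hP := norm_spectralProj_sub_le hM
  have hQ := norm_spectralProj_sub_le hN
  have hC' : ‖Vᴴ‖ ≤ C := by rwa [l2_opNorm_conjTranspose]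
  have hC0 : 0 ≤ C := (norm_nonneg _).trans hC
  have hδ0 : 0 ≤ δ := (norm_nonneg _).trans hMM
  have hVV : ‖V * Vᴴ‖ ≤ C ^ 2 := by
    rw [pow_two]; exact (l2_opNorm_mul _ _).trans (by gcongr)
  have hMn : ‖M‖ ≤ C ^ 2 + δ := by
    calc ‖M‖ = ‖V * Vᴴ - (V * Vᴴ - M)‖ := by rw [sub_sub_cancel]
      _ ≤ _ := (norm_sub_le _ _).trans (by gcongr)
  have hconj : ∀ Y : Matrix n n ℂ, ‖V * Y * Vᴴ‖ ≤ C ^ 2 * ‖Y‖ := fun Y =>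
    calc ‖V * Y * Vᴴ‖ ≤ ‖V * Y‖ * ‖Vᴴ‖ := l2_opNorm_mul _ _
      _ ≤ (‖V‖ * ‖Y‖) * ‖Vᴴ‖ := by gcongr; exact l2_opNorm_mul _ _
      _ ≤ (C * ‖Y‖) * C := by gcongr
      _ = _ := by ring
  have hX : ‖P - V * Q * Vᴴ‖ < 1 := by
    -- The chain is `P ≈ M ≈ M² ≈ (V Vᴴ)² = V (Vᴴ V) Vᴴ ≈ V N Vᴴ ≈ V Q Vᴴ`. Its errors total `5 C² δ
    -- + 3 δ + δ²`, at most `δ (5 C² + 4)` since `δ ≤ 1`.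
    have e : P - V * Q * Vᴴ = (P - M) - (M * M - M) - ((V * Vᴴ) * (V * Vᴴ - M)
        + (V * Vᴴ - M) * M) + V * (Vᴴ * V - N) * Vᴴ - V * (Q - N) * Vᴴ := by
      simp only [Matrix.mul_sub, Matrix.sub_mul, Matrix.mul_assoc]
      abel
    have h3 : ‖(V * Vᴴ) * (V * Vᴴ - M)‖ ≤ C ^ 2 * δ := (norm_mul_le _ _).trans (by gcongr)
    have h4 : ‖(V * Vᴴ - M) * M‖ ≤ δ * (C ^ 2 + δ) := (norm_mul_le _ _).trans (by gcongr)
    have h5 := (hconj (Vᴴ * V - N)).trans (mul_le_mul_of_nonneg_left hVN (sq_nonneg C))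
    have h6 := (hconj (Q - N)).trans (mul_le_mul_of_nonneg_left (hQ.trans
      (mul_le_mul_of_nonneg_left hNN zero_le_two)) (sq_nonneg C))
    rw [e]
    have t1 := norm_sub_le ((P - M) - (M * M - M) - ((V * Vᴴ) * (V * Vᴴ - M)
        + (V * Vᴴ - M) * M) + V * (Vᴴ * V - N) * Vᴴ) (V * (Q - N) * Vᴴ)
    have t2 := norm_add_le ((P - M) - (M * M - M) - ((V * Vᴴ) * (V * Vᴴ - M)
        + (V * Vᴴ - M) * M)) (V * (Vᴴ * V - N) * Vᴴ)
    have t3 := norm_sub_le ((P - M) - (M * M - M)) ((V * Vᴴ) * (V * Vᴴ - M)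
        + (V * Vᴴ - M) * M)
    have t4 := norm_sub_le (P - M) (M * M - M)
    have t5 := norm_add_le ((V * Vᴴ) * (V * Vᴴ - M)) ((V * Vᴴ - M) * M)
    nlinarith
  calc spectralRank M = P.rank := rfl
    _ ≤ (V * Q * Vᴴ).rank := rank_le_rank_of_norm_sub_lt_one (isStarProjection_spectralProj M) hX
    _ ≤ (V * Q).rank := rank_mul_le_left _ _
    _ ≤ Q.rank := rank_mul_le_right _ _

theorem spectralRank_eq_of_approx_mvn {M : Matrix m m ℂ} {N : Matrix n n ℂ} (hM : M.IsHermitian)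
    (hN : N.IsHermitian) (V : Matrix m n ℂ) {C δ : ℝ} (hC : ‖V‖ ≤ C) (hδ : δ ≤ 1)
    (hδ' : δ * (5 * C ^ 2 + 4) < 1) (hMM : ‖M * M - M‖ ≤ δ) (hNN : ‖N * N - N‖ ≤ δ)
    (hVM : ‖V * Vᴴ - M‖ ≤ δ) (hVN : ‖Vᴴ * V - N‖ ≤ δ) :
    spectralRank M = spectralRank N := by
  refine le_antisymm (spectralRank_le_of_approx_mvn hM hN V hC hδ hδ' hMM hNN hVM hVN)
    (spectralRank_le_of_approx_mvn hN hM Vᴴ ?_ hδ hδ' hNN hMM ?_ ?_)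
  · rwa [l2_opNorm_conjTranspose]
  · rwa [conjTranspose_conjTranspose]
  · rwa [conjTranspose_conjTranspose]

end SpectralRank

/-! ### Amplifications of unital extensions -/

section BlockNorm

open scoped Matrix.Norms.L2Operator

variable {m n k : Type*} [Fintype m] [DecidableEq m] [Fintype n] [DecidableEq n] [Fintype k]
  [DecidableEq k]

/-- An injective `*`-homomorphism of C*-algebras is isometric, so the two C*-norms agree. -/
theorem CStarMatrix.norm_eq_l2_opNorm (B : CStarMatrix n n ℂ) :
    ‖B‖ = ‖(CStarMatrix.ofMatrix.symm B : Matrix n n ℂ)‖ :=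
  (NonUnitalStarAlgHom.norm_map (CStarMatrix.ofMatrixStarAlgEquiv (n := n) (A := ℂ))
    (EquivLike.injective _) (CStarMatrix.ofMatrix.symm B)).symm ▸ rfl

/-- The isometry `ℂᵏ → ℂᵐ ⊗ ℂᵏ` onto the `i`-th copy of `ℂᵏ`. -/
def blockIncl (i : m) : Matrix (m × k) k ℂ :=
  Matrix.of fun a b => if a = (i, b) then 1 else 0

theorem blockIncl_conjTranspose_mul_self (i : m) :
    ((blockIncl i : Matrix (m × k) k ℂ)ᴴ * (blockIncl i : Matrix (m × k) k ℂ) : Matrix k k ℂ)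
      = 1 := by
  ext a b
  simp [blockIncl, Matrix.mul_apply, Matrix.one_apply, apply_ite, eq_comm]

theorem norm_blockIncl_le (i : m) : ‖(blockIncl i : Matrix (m × k) k ℂ)‖ ≤ 1 := by
  have h := l2_opNorm_conjTranspose_mul_self (blockIncl i : Matrix (m × k) k ℂ)
  rw [blockIncl_conjTranspose_mul_self] at h
  have h1 : ‖(1 : Matrix k k ℂ)‖ ≤ 1 := (IsStarProjection.one (Matrix k k ℂ)).norm_le
  nlinarith [norm_nonneg (blockIncl i : Matrix (m × k) k ℂ)]

/-- The block matrix whose only nonzero block is `X`, in position `(i, j)`. -/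
def singleBlock (i : m) (j : n) (X : Matrix k k ℂ) : Matrix (m × k) (n × k) ℂ :=
  (blockIncl i : Matrix (m × k) k ℂ) * X * (blockIncl j : Matrix (n × k) k ℂ)ᴴ

omit [Fintype m] [Fintype n] in
theorem singleBlock_apply (i a : m) (j c : n) (X : Matrix k k ℂ) (b d : k) :
    singleBlock i j X (a, b) (c, d) = if a = i ∧ c = j then X b d else 0 := by
  rw [singleBlock, Matrix.mul_apply, Finset.sum_eq_single d, Matrix.mul_apply,
    Finset.sum_eq_single b]
  · by_cases h : a = i <;> by_cases h' : c = j <;> simp [blockIncl, h, h']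
  · intro x _ hx
    simp [blockIncl, hx.symm]
  · simp
  · intro x _ hx
    simp [blockIncl, hx.symm]
  · simp

theorem norm_singleBlock_le (i : m) (j : n) (X : Matrix k k ℂ) : ‖singleBlock i j X‖ ≤ ‖X‖ := by
  have h1 := l2_opNorm_mul ((blockIncl i : Matrix (m × k) k ℂ) * X)
    (blockIncl j : Matrix (n × k) k ℂ)ᴴ
  have h2 := l2_opNorm_mul (blockIncl i : Matrix (m × k) k ℂ) X
  rw [l2_opNorm_conjTranspose] at h1
  calc ‖singleBlock i j X‖ ≤ _ := h1
    _ ≤ (1 * ‖X‖) * 1 := mul_le_mul (h2.trans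
        (mul_le_mul_of_nonneg_right (norm_blockIncl_le _) (norm_nonneg _))) (norm_blockIncl_le _)
        (norm_nonneg _) (by positivity)
    _ = ‖X‖ := by ring

theorem comp_eq_sum_singleBlock (f : Matrix m n (Matrix k k ℂ)) :
    Matrix.comp m n k k ℂ f = ∑ i, ∑ j, singleBlock i j (f i j) := by
  ext ⟨a, b⟩ ⟨c, d⟩
  simp only [Matrix.sum_apply, singleBlock_apply, Matrix.comp_apply]
  rw [Finset.sum_eq_single a, Finset.sum_eq_single c]
  · simp
  · intro x _ hx; simp [hx.symm]
  · simp
  · intro x _ hx; simp [hx.symm]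
  · simp

/-- This crude bound suffices because the number of blocks is fixed by the projection while the
index of the sequence grows. -/
theorem norm_comp_le (f : Matrix m n (Matrix k k ℂ)) :
    ‖Matrix.comp m n k k ℂ f‖ ≤ ∑ i, ∑ j, ‖f i j‖ := by
  rw [comp_eq_sum_singleBlock]
  exact (norm_sum_le _ _).trans (Finset.sum_le_sum fun i _ => (norm_sum_le _ _).trans
    (Finset.sum_le_sum fun j _ => norm_singleBlock_le _ _ _))

end BlockNorm

/-! ### Asymptotic multiplicativity of amplifications and invariance of ranks. -/

section Amplify

open scoped Matrix.Norms.L2Operator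

variable {A : Type*} [NonUnitalCStarAlgebra A] [PartialOrder A] [StarOrderedRing A]
variable {k : ℕ} (φ : A →CP CStarMatrix (Fin k) (Fin k) ℂ)
variable {l m n : Type*} [Fintype l] [DecidableEq l] [Fintype m] [DecidableEq m]
  [Fintype n] [DecidableEq n]

/-- The unital extension `(c, a) ↦ c 1 + φ(a)` of a ccp map to the unitization. -/
noncomputable def unitalExt (z : Unitization ℂ A) : Matrix (Fin k) (Fin k) ℂ :=
  CStarMatrix.ofMatrix.symm (z.fst • (1 : CStarMatrix (Fin k) (Fin k) ℂ) + φ z.snd)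

/-- The amplification of the unital extension of `φ` to rectangular matrices. -/
noncomputable def rectAmplify (p : Matrix m n (Unitization ℂ A)) :
    Matrix (m × Fin k) (n × Fin k) ℂ :=
  Matrix.comp m n (Fin k) (Fin k) ℂ (p.map (unitalExt φ))

theorem norm_unitalExt_le (hφ : ∀ a, ‖φ a‖ ≤ ‖a‖) (z : Unitization ℂ A) :
    ‖unitalExt φ z‖ ≤ ‖z.fst‖ + ‖z.snd‖ := by
  rw [unitalExt, ← CStarMatrix.norm_eq_l2_opNorm]
  have h1 : ‖(1 : CStarMatrix (Fin k) (Fin k) ℂ)‖ ≤ 1 := (IsStarProjection.one _).norm_le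
  calc _ ≤ ‖z.fst • (1 : CStarMatrix (Fin k) (Fin k) ℂ)‖ + ‖φ z.snd‖ := norm_add_le _ _
    _ ≤ ‖z.fst‖ * 1 + ‖z.snd‖ := by
        rw [norm_smul]
        exact add_le_add (mul_le_mul_of_nonneg_left h1 (norm_nonneg _)) (hφ _)
    _ = _ := by rw [mul_one]

/-- All terms with a scalar factor cancel, so passing to the unitization adds no multiplicativity
defect. -/
theorem unitalExt_mul_sub (z w : Unitization ℂ A) :
    unitalExt φ (z * w) - unitalExt φ z * unitalExt φ w
      = CStarMatrix.ofMatrix.symm (φ (z.snd * w.snd) - φ z.snd * φ w.snd) := by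
  change (((z * w).fst • (1 : CStarMatrix (Fin k) (Fin k) ℂ) + φ (z * w).snd)
    - (z.fst • (1 : CStarMatrix (Fin k) (Fin k) ℂ) + φ z.snd)
      * (w.fst • (1 : CStarMatrix (Fin k) (Fin k) ℂ) + φ w.snd))
    = φ (z.snd * w.snd) - φ z.snd * φ w.snd
  rw [Unitization.fst_mul, Unitization.snd_mul, map_add, map_add, map_smul, map_smul, add_mul,
    mul_add, mul_add, smul_mul_smul_comm, smul_mul_assoc, mul_smul_comm, one_mul, one_mul, mul_one]
  abel

theorem unitalExt_add (z w : Unitization ℂ A) :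
    unitalExt φ (z + w) = unitalExt φ z + unitalExt φ w := by
  change ((z + w).fst • (1 : CStarMatrix (Fin k) (Fin k) ℂ) + φ (z + w).snd)
    = (z.fst • (1 : CStarMatrix (Fin k) (Fin k) ℂ) + φ z.snd)
      + (w.fst • (1 : CStarMatrix (Fin k) (Fin k) ℂ) + φ w.snd)
  rw [Unitization.fst_add, Unitization.snd_add, map_add, add_smul]
  abel

theorem unitalExt_zero : unitalExt φ 0 = 0 := by
  change ((0 : Unitization ℂ A).fst • (1 : CStarMatrix (Fin k) (Fin k) ℂ)
    + φ (0 : Unitization ℂ A).snd) = 0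
  rw [Unitization.fst_zero, Unitization.snd_zero, map_zero, zero_smul, add_zero]

theorem unitalExt_sum {ι : Type*} (s : Finset ι) (f : ι → Unitization ℂ A) :
    unitalExt φ (∑ i ∈ s, f i) = ∑ i ∈ s, unitalExt φ (f i) :=
  map_sum (AddMonoidHom.mk' (unitalExt φ) (unitalExt_add φ)) f s

theorem unitalExt_star (z : Unitization ℂ A) : unitalExt φ (star z) = (unitalExt φ z)ᴴ := by
  change ((star z).fst • (1 : CStarMatrix (Fin k) (Fin k) ℂ) + φ (star z).snd)
    = star (z.fst • (1 : CStarMatrix (Fin k) (Fin k) ℂ) + φ z.snd)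
  rw [Unitization.fst_star, Unitization.snd_star, map_star, star_add, star_smul, star_one]

omit [Fintype m] [DecidableEq m] [Fintype n] [DecidableEq n] in
theorem rectAmplify_conjTranspose (v : Matrix m n (Unitization ℂ A)) :
    rectAmplify φ vᴴ = (rectAmplify φ v)ᴴ := by
  ext ⟨a, b⟩ ⟨c, d⟩
  exact congrFun (congrFun (unitalExt_star φ (v c a)) b) d

omit [DecidableEq m] in
theorem isHermitian_rectAmplify {p : Matrix m m (Unitization ℂ A)} (hp : IsStarProjection p) :
    (rectAmplify φ p).IsHermitian := by
  rw [Matrix.IsHermitian, ← rectAmplify_conjTranspose, hp.mat_star]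

theorem norm_rectAmplify_le (hφ : ∀ a, ‖φ a‖ ≤ ‖a‖) (v : Matrix m n (Unitization ℂ A)) :
    ‖rectAmplify φ v‖ ≤ ∑ i, ∑ j, (‖(v i j).fst‖ + ‖(v i j).snd‖) :=
  (norm_comp_le _).trans (Finset.sum_le_sum fun _ _ => Finset.sum_le_sum fun _ _ =>
    norm_unitalExt_le φ hφ _)

omit [DecidableEq m] in
theorem norm_rectAmplify_mul_sub_le (v : Matrix l m (Unitization ℂ A))
    (w : Matrix m n (Unitization ℂ A)) :
    ‖rectAmplify φ v * rectAmplify φ w - rectAmplify φ (v * w)‖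
      ≤ ∑ i, ∑ j, ∑ r, ‖φ ((v i r).snd * (w r j).snd) - φ (v i r).snd * φ (w r j).snd‖ := by
  have e : rectAmplify φ (v * w) - rectAmplify φ v * rectAmplify φ w
      = Matrix.comp l n (Fin k) (Fin k) ℂ (Matrix.of fun i j => ∑ r,
        (unitalExt φ (v i r * w r j) - unitalExt φ (v i r) * unitalExt φ (w r j))) := by
    ext ⟨a, b⟩ ⟨c, d⟩
    simp only [rectAmplify, Matrix.sub_apply, Matrix.comp_apply, Matrix.map_apply,
      Matrix.mul_apply, unitalExt_sum, Matrix.sum_apply, Matrix.of_apply, Fintype.sum_prod_type,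
      Finset.sum_sub_distrib]
  rw [norm_sub_rev, e]
  refine (norm_comp_le _).trans (Finset.sum_le_sum fun i _ => Finset.sum_le_sum fun j _ =>
    (norm_sum_le _ _).trans (Finset.sum_le_sum fun r _ => le_of_eq ?_))
  rw [unitalExt_mul_sub, ← CStarMatrix.norm_eq_l2_opNorm]

omit [DecidableEq m] in
theorem CcpApprox.eventually_norm_rectAmplify_mul_sub_le (Φ : CcpApprox A)
    (v : Matrix l m (Unitization ℂ A)) (w : Matrix m n (Unitization ℂ A)) {δ : ℝ} (hδ : 0 < δ) :
    ∀ᶠ s in atTop, ‖rectAmplify (Φ.φ s) v * rectAmplify (Φ.φ s) w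
      - rectAmplify (Φ.φ s) (v * w)‖ ≤ δ := by
  have h : Tendsto (fun s => ∑ i, ∑ j, ∑ r, ‖Φ.φ s ((v i r).snd * (w r j).snd)
      - Φ.φ s (v i r).snd * Φ.φ s (w r j).snd‖) atTop (𝓝 0) := by
    have : (0 : ℝ) = ∑ _i : l, ∑ _j : n, ∑ _r : m, (0 : ℝ) := by simp
    rw [this]
    exact tendsto_finsetSum _ fun i _ => tendsto_finsetSum _ fun j _ =>
      tendsto_finsetSum _ fun r _ => Φ.asymp_mul _ _
  filter_upwards [h.eventually (ge_mem_nhds hδ)] with s hs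
  exact (norm_rectAmplify_mul_sub_le _ _ _).trans hs

theorem CcpApprox.eventually_projRank_eq (Φ : CcpApprox A) {p q : MatProj (Unitization ℂ A)}
    (h : MvN p.2.1 q.2.1) :
    ∀ᶠ s in atTop, projRank (Φ.φ s) p = projRank (Φ.φ s) q := by
  obtain ⟨v, hv1, hv2⟩ := h
  set C := ∑ i, ∑ j, (‖(v i j).fst‖ + ‖(v i j).snd‖)
  obtain ⟨δ, hδ0, hδ1, hδ⟩ : ∃ δ : ℝ, 0 < δ ∧ δ ≤ 1 ∧ δ * (5 * C ^ 2 + 4) < 1 := by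
    -- `C` depends only on `v`, by contractivity, so one tolerance serves all indices.
    refine ⟨(5 * C ^ 2 + 5)⁻¹, by positivity, inv_le_one_of_one_le₀ (by nlinarith [sq_nonneg C]), ?_⟩
    rw [inv_mul_lt_one₀ (by positivity)]
    linarith
  filter_upwards [Φ.eventually_norm_rectAmplify_mul_sub_le p.2.1 p.2.1 hδ0,
    Φ.eventually_norm_rectAmplify_mul_sub_le q.2.1 q.2.1 hδ0,
    Φ.eventually_norm_rectAmplify_mul_sub_le v vᴴ hδ0,
    Φ.eventually_norm_rectAmplify_mul_sub_le vᴴ v hδ0] with s h1 h2 h3 h4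
  rw [p.2.2.mat_mul] at h1
  rw [q.2.2.mat_mul] at h2
  rw [hv1, rectAmplify_conjTranspose] at h3
  rw [hv2, rectAmplify_conjTranspose] at h4
  exact congrArg Nat.cast (spectralRank_eq_of_approx_mvn (isHermitian_rectAmplify _ p.2.2)
    (isHermitian_rectAmplify _ q.2.2) _ (norm_rectAmplify_le _ (Φ.contractive s) v) hδ1 hδ
    h1 h2 h3 h4)

omit [Fintype m] [DecidableEq m] [Fintype n] [DecidableEq n] in
theorem rectAmplify_dsum (p : Matrix m m (Unitization ℂ A)) (q : Matrix n n (Unitization ℂ A)) :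
    rectAmplify φ (dsum p q) = (fromBlocks (rectAmplify φ p) 0 0 (rectAmplify φ q)).submatrix
      (Equiv.sumProdDistrib m n (Fin k)) (Equiv.sumProdDistrib m n (Fin k)) := by
  ext ⟨i, a⟩ ⟨j, b⟩
  rcases i with i | i <;> rcases j with j | j <;> simp [dsum, rectAmplify, unitalExt_zero]

theorem projRank_add (p q : MatProj (Unitization ℂ A)) :
    projRank φ (p.add q) = projRank φ p + projRank φ q := by
  have hp := isHermitian_rectAmplify φ p.2.2
  have hq := isHermitian_rectAmplify φ q.2.2
  have hs := spectralRank_submatrix (isHermitian_rectAmplify φ (p.2.2.dsum q.2.2))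
    ((finSumFinEquiv (m := p.1) (n := q.1)).symm.prodCongr (Equiv.refl (Fin k)))
  rw [rectAmplify_dsum, spectralRank_submatrix (hp.fromBlocks (by simp) hq),
    spectralRank_fromBlocks hp hq, ← rectAmplify_dsum] at hs
  exact (congrArg Nat.cast hs).trans (Nat.cast_add _ _)

end Amplify

/-! ### The induced maps on `K₀` -/

section Pushforward

theorem projClass_add {R : Type*} [NonUnitalRing R] [StarRing R] (p q : MatProj R) :
    projClass (p.add q) = projClass p + projClass q :=
  map_add Algebra.GrothendieckAddGroup.of (MvNSemigroup.mk p) (MvNSemigroup.mk q)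

/-- `V(R)` need not be cancellative, so equality in the Grothendieck group only gives equivalence
after adding some `r`. -/
theorem exists_mvn_add_of_projClass_eq {R : Type*} [NonUnitalRing R] [StarRing R]
    {p q : MatProj R} (h : projClass p = projClass q) :
    ∃ r : MatProj R, MvN (r.add p).2.1 (r.add q).2.1 := by
  obtain ⟨⟨c, _⟩, hc⟩ := ((AddLocalization.addMonoidOf
    (⊤ : AddSubmonoid (MvNSemigroup R))).eq_iff_exists).1 h
  obtain ⟨r, rfl⟩ := Quotient.exists_rep c
  exact ⟨r, Quotient.exact hc⟩

variable {A : Type*} [NonUnitalCStarAlgebra A] [PartialOrder A] [StarOrderedRing A]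

namespace CcpApprox

variable (Φ : CcpApprox A)

theorem eventually_projRank_eq_of_projClass_eq {p q : MatProj (Unitization ℂ A)}
    (h : projClass p = projClass q) :
    ∀ᶠ s in atTop, projRank (Φ.φ s) p = projRank (Φ.φ s) q := by
  obtain ⟨r, hr⟩ := exists_mvn_add_of_projClass_eq h
  filter_upwards [Φ.eventually_projRank_eq hr] with s hs
  rw [projRank_add, projRank_add] at hs
  exact add_left_cancel hs

/-- Frees `pushforward` from its fixed choice of representatives, at the price of discarding
finitely many indices. -/
theorem eventually_pushforward_eq {x : K0 A} {p q : MatProj (Unitization ℂ A)}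
    (h : (x : GrothendieckV (Unitization ℂ A)) = projClass p - projClass q) :
    ∀ᶠ s in atTop, Φ.pushforward x s = projRank (Φ.φ s) p - projRank (Φ.φ s) q := by
  set pq := (exists_projClass_sub x.1).choose
  have h' : (x : GrothendieckV (Unitization ℂ A)) = projClass pq.1 - projClass pq.2 :=
    (exists_projClass_sub x.1).choose_spec
  have e : projClass (pq.1.add q) = projClass (p.add pq.2) := by
    rw [projClass_add, projClass_add, ← sub_eq_sub_iff_add_eq_add, ← h', h]
  filter_upwards [Φ.eventually_projRank_eq_of_projClass_eq e] with s hs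
  rw [projRank_add, projRank_add] at hs
  exact sub_eq_sub_iff_add_eq_add.2 hs

/-- The homomorphism from `K₀(A)` to integer sequences modulo eventual equality. -/
noncomputable def pushforwardGerm : K0 A →+ Germ (atTop : Filter ℕ) ℤ :=
  AddMonoidHom.mk' (fun x => (Φ.pushforward x : Germ (atTop : Filter ℕ) ℤ)) fun x y => by
    rw [← Germ.coe_add, Germ.coe_eq]
    obtain ⟨⟨p, q⟩, hx⟩ := exists_projClass_sub x.1
    obtain ⟨⟨p', q'⟩, hy⟩ := exists_projClass_sub y.1
    have hxy : ((x + y : K0 A) : GrothendieckV (Unitization ℂ A))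
        = projClass (p.add p') - projClass (q.add q') := by
      rw [AddSubgroup.coe_add, hx, hy, projClass_add, projClass_add]
      abel
    filter_upwards [Φ.eventually_pushforward_eq hx, Φ.eventually_pushforward_eq hy,
      Φ.eventually_pushforward_eq hxy] with s h1 h2 h3
    rw [h3, Pi.add_apply, h1, h2, projRank_add, projRank_add]
    ring

theorem eventually_pushforward_zsmul (c : ℤ) (x : K0 A) :
    ∀ᶠ s in atTop, Φ.pushforward (c • x) s = c * Φ.pushforward x s := by
  have h := map_zsmul Φ.pushforwardGerm c x
  change (Φ.pushforward (c • x) : Germ (atTop : Filter ℕ) ℤ)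
    = c • (Φ.pushforward x : Germ (atTop : Filter ℕ) ℤ) at h
  rw [← Germ.coe_smul, Germ.coe_eq] at h
  filter_upwards [h] with s hs
  rw [hs, Pi.smul_apply, smul_eq_mul]

theorem eventually_pushforward_zero :
    ∀ᶠ s in atTop, Φ.pushforward (0 : K0 A) s = 0 := by
  simpa using Φ.eventually_pushforward_zsmul 0 0

theorem eventually_pushforward_nonneg {x : K0 A} (hx : x ∈ K0Pos A) :
    ∀ᶠ s in atTop, 0 ≤ Φ.pushforward x s := by
  obtain ⟨p, hp⟩ := hx
  let z : MatProj (Unitization ℂ A) := ⟨0, 0, IsStarProjection.zero _⟩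
  have hz : projClass z = 0 := map_zero Algebra.GrothendieckAddGroup.of
  filter_upwards [Φ.eventually_pushforward_eq (p := p.map (unitizationInr A)) (q := z)
    (by rw [hp, hz, sub_zero])] with s hs
  have h0 : projRank (Φ.φ s) z = 0 := by
    rw [projRank, spectralRank, Nat.cast_eq_zero, ← Nat.le_zero]
    exact (Matrix.rank_le_card_width _).trans (by simp [z])
  rw [hs, h0, sub_zero]
  exact Nat.cast_nonneg _

/-- The subsequence of a sequence of approximate morphisms. -/
def comp (σ : ℕ → ℕ) (hσ : Tendsto σ atTop atTop) : CcpApprox A where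
  k s := Φ.k (σ s)
  φ s := Φ.φ (σ s)
  contractive s := Φ.contractive (σ s)
  asymp_mul a b := (Φ.asymp_mul a b).comp hσ
  asymp_isometric a := (Φ.asymp_isometric a).comp hσ

theorem exists_forall_of_frequently {x : K0 A} {P : ℤ → Prop}
    (h : ∃ᶠ s in atTop, P (Φ.pushforward x s)) :
    ∃ Ψ : CcpApprox A, ∀ s, P (Ψ.pushforward x s) := by
  obtain ⟨σ, hσ, hP⟩ := extraction_of_frequently_atTop h
  exact ⟨Φ.comp σ hσ.tendsto_atTop, hP⟩

end CcpApprox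

omit [PartialOrder A] [StarOrderedRing A] in
theorem zero_mem_K0Pos : (0 : K0 A) ∈ K0Pos A :=
  ⟨⟨0, 0, IsStarProjection.zero _⟩, (map_zero
    (Algebra.GrothendieckAddGroup.of.comp (MvNSemigroup.map (unitizationInr A)))).symm⟩

end Pushforward

/-! ### Direct sums of completely positive maps -/

section DirectSum

/-- The block diagonal sum in `Mₖ₊ₗ(ℂ)` of matrices in `Mₖ(ℂ)` and `Mₗ(ℂ)`. -/
def finDsum {k l : ℕ} (X : Matrix (Fin k) (Fin k) ℂ) (Y : Matrix (Fin l) (Fin l) ℂ) :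
    Matrix (Fin (k + l)) (Fin (k + l)) ℂ :=
  (dsum X Y).submatrix finSumFinEquiv.symm finSumFinEquiv.symm

section FinDsum

variable {k l : ℕ} (X X' : Matrix (Fin k) (Fin k) ℂ) (Y Y' : Matrix (Fin l) (Fin l) ℂ)

theorem finDsum_apply (i j : Fin k ⊕ Fin l) :
    finDsum X Y (finSumFinEquiv i) (finSumFinEquiv j) = dsum X Y i j := by
  simp [finDsum]

theorem finDsum_add : finDsum (X + X') (Y + Y') = finDsum X Y + finDsum X' Y' := by
  have h : dsum (X + X') (Y + Y') = dsum X Y + dsum X' Y' := by simp [dsum, fromBlocks_add]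
  rw [finDsum, h]
  rfl

theorem finDsum_smul (c : ℂ) : finDsum (c • X) (c • Y) = c • finDsum X Y := by
  have h : dsum (c • X) (c • Y) = c • dsum X Y := by simp [dsum, fromBlocks_smul]
  rw [finDsum, h]
  rfl

theorem finDsum_mul : finDsum (X * X') (Y * Y') = finDsum X Y * finDsum X' Y' := by
  rw [finDsum, finDsum, finDsum, Matrix.submatrix_mul_equiv, dsum, dsum, dsum,
    fromBlocks_multiply]
  simp

theorem finDsum_conjTranspose : finDsum Xᴴ Yᴴ = (finDsum X Y)ᴴ := by
  rw [finDsum, finDsum, Matrix.conjTranspose_submatrix, dsum, dsum, fromBlocks_conjTranspose]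
  simp

theorem finDsum_zero : finDsum (0 : Matrix (Fin k) (Fin k) ℂ) (0 : Matrix (Fin l) (Fin l) ℂ)
    = 0 := by
  rw [finDsum, dsum, fromBlocks_zero, Matrix.submatrix_zero]
  rfl

theorem finDsum_one : finDsum (1 : Matrix (Fin k) (Fin k) ℂ) (1 : Matrix (Fin l) (Fin l) ℂ)
    = 1 := by
  rw [finDsum, dsum, fromBlocks_one, Matrix.submatrix_one_equiv]

theorem finDsum_injective {X X' : Matrix (Fin k) (Fin k) ℂ} {Y Y' : Matrix (Fin l) (Fin l) ℂ}
    (h : finDsum X Y = finDsum X' Y') : X = X' ∧ Y = Y' := by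
  refine ⟨?_, ?_⟩ <;> ext i j
  · simpa only [finDsum_apply, dsum, fromBlocks_apply₁₁] using
      congrFun (congrFun h (finSumFinEquiv (.inl i))) (finSumFinEquiv (.inl j))
  · simpa only [finDsum_apply, dsum, fromBlocks_apply₂₂] using
      congrFun (congrFun h (finSumFinEquiv (.inr i))) (finSumFinEquiv (.inr j))

end FinDsum

/-- The block diagonal embedding `Mₖ(ℂ) × Mₗ(ℂ) → Mₖ₊ₗ(ℂ)`. -/
noncomputable def blockDiagHom (k l : ℕ) :
    CStarMatrix (Fin k) (Fin k) ℂ × CStarMatrix (Fin l) (Fin l) ℂ →⋆ₙₐ[ℂ]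
      CStarMatrix (Fin (k + l)) (Fin (k + l)) ℂ where
  toFun X := CStarMatrix.ofMatrix
    (finDsum (CStarMatrix.ofMatrix.symm X.1) (CStarMatrix.ofMatrix.symm X.2))
  map_smul' c X := finDsum_smul X.1 X.2 c
  map_zero' := finDsum_zero
  map_add' X Y := finDsum_add X.1 Y.1 X.2 Y.2
  map_mul' X Y := finDsum_mul X.1 Y.1 X.2 Y.2
  map_star' X := finDsum_conjTranspose X.1 X.2

theorem blockDiagHom_injective (k l : ℕ) : Function.Injective (blockDiagHom k l) :=
  fun _ _ h => Prod.ext (finDsum_injective h).1 (finDsum_injective h).2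

theorem norm_blockDiagHom {k l : ℕ}
    (X : CStarMatrix (Fin k) (Fin k) ℂ × CStarMatrix (Fin l) (Fin l) ℂ) :
    ‖blockDiagHom k l X‖ = max ‖X.1‖ ‖X.2‖ :=
  NonUnitalStarAlgHom.norm_map _ (blockDiagHom_injective k l) X

variable {A : Type*} [NonUnitalCStarAlgebra A] [PartialOrder A] [StarOrderedRing A]

/-- The direct sum of two completely positive maps into matrix algebras. -/
noncomputable def cpSum {k l : ℕ} (φ : A →CP CStarMatrix (Fin k) (Fin k) ℂ)
    (ψ : A →CP CStarMatrix (Fin l) (Fin l) ℂ) :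
    A →CP CStarMatrix (Fin (k + l)) (Fin (k + l)) ℂ where
  toFun a := blockDiagHom k l (φ a, ψ a)
  map_add' a b := by
    rw [map_add, map_add, ← map_add (blockDiagHom k l), Prod.mk_add_mk]
  map_smul' c a := by
    rw [map_smul, map_smul, RingHom.id_apply, ← map_smul (blockDiagHom k l), Prod.smul_mk]
  map_cstarMatrix_nonneg' r N hN := by
    -- Each corner inclusion is a `*`-homomorphism, hence completely positive; the direct sum is the
    -- sum of the two corner maps.
    have h1 : 0 ≤ CStarMatrix.map (N.map φ) ((blockDiagHom k l).comp (NonUnitalStarAlgHom.inl ℂ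
        (CStarMatrix (Fin k) (Fin k) ℂ) (CStarMatrix (Fin l) (Fin l) ℂ))) :=
      CompletelyPositiveMapClass.map_cstarMatrix_nonneg' _ r _ (φ.map_cstarMatrix_nonneg N hN)
    have h2 : 0 ≤ CStarMatrix.map (N.map ψ) ((blockDiagHom k l).comp (NonUnitalStarAlgHom.inr ℂ
        (CStarMatrix (Fin k) (Fin k) ℂ) (CStarMatrix (Fin l) (Fin l) ℂ))) :=
      CompletelyPositiveMapClass.map_cstarMatrix_nonneg' _ r _ (ψ.map_cstarMatrix_nonneg N hN)
    refine (add_nonneg h1 h2).trans_eq ?_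
    refine CStarMatrix.ext fun i j => ?_
    change blockDiagHom k l (φ (N i j), 0) + blockDiagHom k l (0, ψ (N i j))
      = blockDiagHom k l (φ (N i j), ψ (N i j))
    rw [← map_add, Prod.mk_add_mk, add_zero, zero_add]

variable {k l : ℕ} (φ : A →CP CStarMatrix (Fin k) (Fin k) ℂ)
  (ψ : A →CP CStarMatrix (Fin l) (Fin l) ℂ)

theorem norm_cpSum (a : A) : ‖cpSum φ ψ a‖ = max ‖φ a‖ ‖ψ a‖ :=
  norm_blockDiagHom (φ a, ψ a)

theorem norm_cpSum_mul_sub (a b : A) :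
    ‖cpSum φ ψ (a * b) - cpSum φ ψ a * cpSum φ ψ b‖
      = max ‖φ (a * b) - φ a * φ b‖ ‖ψ (a * b) - ψ a * ψ b‖ := by
  change ‖blockDiagHom k l (φ (a * b), ψ (a * b))
    - blockDiagHom k l (φ a, ψ a) * blockDiagHom k l (φ b, ψ b)‖ = _
  rw [← map_mul, ← map_sub, norm_blockDiagHom]
  rfl

theorem unitalExt_cpSum (z : Unitization ℂ A) :
    unitalExt (cpSum φ ψ) z = finDsum (unitalExt φ z) (unitalExt ψ z) := by
  have h (X : Matrix (Fin k) (Fin k) ℂ) (Y : Matrix (Fin l) (Fin l) ℂ) :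
      z.fst • (1 : Matrix (Fin (k + l)) (Fin (k + l)) ℂ) + finDsum X Y
        = finDsum (z.fst • 1 + X) (z.fst • 1 + Y) := by
    rw [finDsum_add, finDsum_smul, finDsum_one]
  exact h (φ z.snd) (ψ z.snd)

theorem rectAmplify_cpSum {m : Type*} (p : Matrix m m (Unitization ℂ A)) :
    rectAmplify (cpSum φ ψ) p
      = (fromBlocks (rectAmplify φ p) 0 0 (rectAmplify ψ p)).submatrix
        (((Equiv.refl m).prodCongr finSumFinEquiv.symm).trans (Equiv.prodSumDistrib _ _ _))
        (((Equiv.refl m).prodCongr finSumFinEquiv.symm).trans (Equiv.prodSumDistrib _ _ _)) := by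
  ext ⟨i, a⟩ ⟨j, b⟩
  obtain ⟨a, rfl⟩ := finSumFinEquiv.surjective a
  obtain ⟨b, rfl⟩ := finSumFinEquiv.surjective b
  rw [rectAmplify, Matrix.comp_apply, Matrix.map_apply, unitalExt_cpSum, finDsum_apply]
  rcases a with a | a <;> rcases b with b | b <;> simp [dsum, rectAmplify]

theorem projRank_cpSum (p : MatProj (Unitization ℂ A)) :
    projRank (cpSum φ ψ) p = projRank φ p + projRank ψ p := by
  have hp := isHermitian_rectAmplify φ p.2.2
  have hq := isHermitian_rectAmplify ψ p.2.2
  change ((spectralRank (rectAmplify (cpSum φ ψ) p.2.1) : ℕ) : ℤ) = _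
  rw [rectAmplify_cpSum, spectralRank_submatrix (hp.fromBlocks (by simp) hq), spectralRank_fromBlocks hp hq,
    Nat.cast_add]
  rfl

/-- Counting `c + 1` copies excludes the empty sum, which would not preserve norms. -/
theorem exists_multiple_cp (c : ℕ) :
    ∃ (N : ℕ) (θ : A →CP CStarMatrix (Fin N) (Fin N) ℂ), (∀ a, ‖θ a‖ = ‖φ a‖) ∧
      (∀ a b, ‖θ (a * b) - θ a * θ b‖ = ‖φ (a * b) - φ a * φ b‖) ∧
      ∀ p, projRank θ p = (c + 1) * projRank φ p := by
  induction c with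
  | zero => exact ⟨k, φ, fun _ => rfl, fun _ _ => rfl, fun p => by simp⟩
  | succ c ih =>
    obtain ⟨N, θ, h1, h2, h3⟩ := ih
    refine ⟨N + k, cpSum θ φ, fun a => ?_, fun a b => ?_, fun p => ?_⟩
    · rw [norm_cpSum, h1, max_self]
    · rw [norm_cpSum_mul_sub, h2, max_self]
    · rw [projRank_cpSum, h3]
      push_cast
      ring

theorem exists_weighted_sum_cp {c d : ℕ} (hc : 0 < c) (hd : 0 < d) :
    ∃ (N : ℕ) (θ : A →CP CStarMatrix (Fin N) (Fin N) ℂ), (∀ a, ‖θ a‖ = max ‖φ a‖ ‖ψ a‖) ∧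
      (∀ a b, ‖θ (a * b) - θ a * θ b‖
        = max ‖φ (a * b) - φ a * φ b‖ ‖ψ (a * b) - ψ a * ψ b‖) ∧
      ∀ p, projRank θ p = c * projRank φ p + d * projRank ψ p := by
  obtain ⟨N, θ, h1, h2, h3⟩ := exists_multiple_cp φ (c - 1)
  obtain ⟨N', θ', h1', h2', h3'⟩ := exists_multiple_cp ψ (d - 1)
  refine ⟨N + N', cpSum θ θ', fun a => ?_, fun a b => ?_, fun p => ?_⟩
  · rw [norm_cpSum, h1, h1']
  · rw [norm_cpSum_mul_sub, h2, h2']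
  · rw [projRank_cpSum, h3, h3', Nat.cast_sub hc, Nat.cast_sub hd]
    push_cast
    ring

namespace CcpApprox

/-- The identity holds at every index because all three pushforwards use the same representatives of
`x`. -/
theorem exists_weighted_sum (Φ Ψ : CcpApprox A) (c d : ℕ → ℕ) (hc : ∀ s, 0 < c s)
    (hd : ∀ s, 0 < d s) :
    ∃ Θ : CcpApprox A, ∀ x s,
      Θ.pushforward x s = c s * Φ.pushforward x s + d s * Ψ.pushforward x s := by
  choose N θ h1 h2 h3 using fun s => exists_weighted_sum_cp (Φ.φ s) (Ψ.φ s) (hc s) (hd s)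
  refine ⟨⟨N, θ, fun s a => ?_, fun a b => ?_, fun a => ?_⟩, fun x s => ?_⟩
  · rw [h1]
    exact max_le (Φ.contractive s a) (Ψ.contractive s a)
  · simp only [h2]
    simpa using (Φ.asymp_mul a b).max (Ψ.asymp_mul a b)
  · simp only [h1]
    simpa using (Φ.asymp_isometric a).max (Ψ.asymp_isometric a)
  · simp only [pushforward, h3]
    ring

theorem exists_pushforward_eq_zero {x : K0 A} (Φ Ψ : CcpApprox A)
    (hΦ : ∃ᶠ s in atTop, Φ.pushforward x s ≤ 0) (hΨ : ∃ᶠ s in atTop, 0 ≤ Ψ.pushforward x s) :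
    ∃ Θ : CcpApprox A, ∀ᶠ s in atTop, Θ.pushforward x s = 0 := by
  by_cases h1 : ∃ᶠ s in atTop, Φ.pushforward x s = 0
  · obtain ⟨Θ, h⟩ := Φ.exists_forall_of_frequently (P := (· = 0)) h1
    exact ⟨Θ, .of_forall h⟩
  by_cases h2 : ∃ᶠ s in atTop, Ψ.pushforward x s = 0
  · obtain ⟨Θ, h⟩ := Ψ.exists_forall_of_frequently (P := (· = 0)) h2
    exact ⟨Θ, .of_forall h⟩
  obtain ⟨Φ', hΦ'⟩ := Φ.exists_forall_of_frequently (P := fun z => z < 0)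
    ((hΦ.and_eventually (not_frequently.1 h1)).mono fun s h => lt_of_le_of_ne h.1 h.2)
  obtain ⟨Ψ', hΨ'⟩ := Ψ.exists_forall_of_frequently (P := fun z => 0 < z)
    ((hΨ.and_eventually (not_frequently.1 h2)).mono fun s h => lt_of_le_of_ne h.1 (Ne.symm h.2))
  -- The weights are the absolute values of the opposite ranks, so the contributions cancel.
  obtain ⟨Θ, hΘ⟩ := exists_weighted_sum Φ' Ψ' (fun s => (Ψ'.pushforward x s).natAbs)
    (fun s => (Φ'.pushforward x s).natAbs) (fun s => Int.natAbs_pos.2 (hΨ' s).ne')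
    (fun s => Int.natAbs_pos.2 (hΦ' s).ne)
  refine ⟨Θ, .of_forall fun s => ?_⟩
  rw [hΘ, Int.natCast_natAbs, Int.natCast_natAbs, abs_of_pos (hΨ' s), abs_of_neg (hΦ' s)]
  ring

end CcpApprox

end DirectSum

/-! ### Approximate morphisms from quasidiagonality -/

section Compression

universe u

variable {A : Type u} [NonUnitalCStarAlgebra A] [PartialOrder A] [StarOrderedRing A]

theorem exists_eq_star_mul_self {B : Type*} [NonUnitalCStarAlgebra B] [PartialOrder B]
    [StarOrderedRing B] {x : B} (hx : 0 ≤ x) : ∃ y, x = star y * y :=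
  CStarAlgebra.nonneg_iff_eq_star_mul_self.1 hx

/-- A block matrix is positive if the matrix of its scalar entries is positive semidefinite. -/
theorem CStarMatrix.nonneg_of_posSemidef {r d : ℕ}
    (N : CStarMatrix (Fin r) (Fin r) (CStarMatrix (Fin d) (Fin d) ℂ))
    (hN : (Matrix.of fun x y : Fin r × Fin d => N x.1 y.1 x.2 y.2).PosSemidef) : 0 ≤ N := by
  obtain ⟨C, hC⟩ : ∃ C : Matrix (Fin r × Fin d) (Fin r × Fin d) ℂ,
      (Matrix.of fun x y : Fin r × Fin d => N x.1 y.1 x.2 y.2) = Cᴴ * C := by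
    open scoped MatrixOrder in
    exact CStarAlgebra.nonneg_iff_eq_star_mul_self.1 hN.nonneg
  let B : Matrix (Fin r) (Fin r) (Matrix (Fin d) (Fin d) ℂ) := (Matrix.comp _ _ _ _ ℂ).symm C
  have h : N = CStarMatrix.ofMatrix (Bᴴ * B) := by
    ext i j a b
    have h1 := congrFun (congrFun hC (i, a)) (j, b)
    change N i j a b = (Bᴴ * B) i j a b
    rw [Matrix.mul_apply, Matrix.sum_apply]
    simp only [Matrix.of_apply, Matrix.mul_apply, Fintype.sum_prod_type] at h1 ⊢
    exact h1
  rw [h]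
  exact star_mul_self_nonneg (CStarMatrix.ofMatrix B :
    CStarMatrix (Fin r) (Fin r) (CStarMatrix (Fin d) (Fin d) ℂ))

variable {H : Type*} [NormedAddCommGroup H] [InnerProductSpace ℂ H] [CompleteSpace H]

open ContinuousLinearMap in
/-- The compression `T ↦ V* T V` of operators on `H` to matrices, for `V : ℂᵈ → H`. -/
noncomputable def compression {d : ℕ} (V : EuclideanSpace ℂ (Fin d) →L[ℂ] H) :
    (H →L[ℂ] H) →ₗ[ℂ] CStarMatrix (Fin d) (Fin d) ℂ where
  toFun T := CStarMatrix.ofMatrix ((toEuclideanCLM (𝕜 := ℂ)).symm (adjoint V ∘L T ∘L V))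
  map_add' S T := by
    rw [ContinuousLinearMap.add_comp, ContinuousLinearMap.comp_add, map_add]
    rfl
  map_smul' c T := by
    rw [ContinuousLinearMap.smul_comp, ContinuousLinearMap.comp_smul, map_smul]
    rfl

section

variable {d : ℕ} (V : EuclideanSpace ℂ (Fin d) →L[ℂ] H)

open ContinuousLinearMap

theorem compression_apply (T : H →L[ℂ] H) (i j : Fin d) :
    compression V T i j
      = inner ℂ (V (EuclideanSpace.single i 1)) (T (V (EuclideanSpace.single j 1))) := by
  have h (M : Matrix (Fin d) (Fin d) ℂ) : M i j = inner ℂ (EuclideanSpace.single i (1 : ℂ))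
      (toEuclideanCLM (𝕜 := ℂ) M (EuclideanSpace.single j 1)) := by
    rw [EuclideanSpace.inner_single_left]
    simp
  change (toEuclideanCLM (𝕜 := ℂ)).symm (adjoint V ∘L T ∘L V) i j = _
  refine (h _).trans ?_
  rw [StarAlgEquiv.apply_symm_apply, ContinuousLinearMap.comp_apply, adjoint_inner_right,
    ContinuousLinearMap.comp_apply]

theorem norm_compression (T : H →L[ℂ] H) : ‖compression V T‖ = ‖adjoint V ∘L T ∘L V‖ := by
  rw [CStarMatrix.norm_eq_l2_opNorm, cstar_norm_def]
  change ‖toEuclideanCLM (𝕜 := ℂ) ((toEuclideanCLM (𝕜 := ℂ)).symm (adjoint V ∘L T ∘L V))‖ = _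
  rw [StarAlgEquiv.apply_symm_apply]

theorem compression_mul (S T : H →L[ℂ] H) :
    compression V S * compression V T = compression V (S ∘L (V ∘L adjoint V) ∘L T) := by
  change (toEuclideanCLM (𝕜 := ℂ)).symm (adjoint V ∘L S ∘L V)
    * (toEuclideanCLM (𝕜 := ℂ)).symm (adjoint V ∘L T ∘L V) = (toEuclideanCLM (𝕜 := ℂ)).symm _
  rw [← map_mul]
  rfl

/-- The completely positive map `a ↦ V* π(a) V` for a representation `π` on `H` and an operator
`V : ℂᵈ → H`. -/
noncomputable def cpCompression (π : A →⋆ₙₐ[ℂ] (H →L[ℂ] H)) :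
    A →CP CStarMatrix (Fin d) (Fin d) ℂ where
  toFun a := compression V (π a)
  map_add' a b := by rw [map_add, map_add]
  map_smul' c a := by rw [map_smul, map_smul]; rfl
  map_cstarMatrix_nonneg' r N hN := by
    obtain ⟨B, rfl⟩ := exists_eq_star_mul_self hN
    refine CStarMatrix.nonneg_of_posSemidef _ ?_
    -- With `N = B* B`, each row `l` of `B` contributes the Gram matrix of the vectors `π(B l i) V
    -- e_b`.
    have h : (Matrix.of fun x y : Fin r × Fin d =>
        compression V (π ((star B * B) x.1 y.1)) x.2 y.2)
        = ∑ l, Matrix.gram ℂ fun x : Fin r × Fin d =>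
          π (B l x.1) (V (EuclideanSpace.single x.2 1)) := by
      ext x y
      rw [Matrix.of_apply, compression_apply, CStarMatrix.mul_apply, map_sum, _root_.sum_apply, inner_sum,
        Matrix.sum_apply]
      refine Finset.sum_congr rfl fun l _ => ?_
      rw [Matrix.gram_apply, CStarMatrix.star_apply, map_mul, map_star, mul_apply_eq_comp,
        ContinuousLinearMap.star_eq_adjoint, adjoint_inner_right]
    change (Matrix.of fun x y : Fin r × Fin d =>
        compression V (π ((star B * B) x.1 y.1)) x.2 y.2).PosSemidef
    rw [h]
    exact Matrix.posSemidef_sum _ fun l _ => Matrix.posSemidef_gram _ _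

theorem cpCompression_apply (π : A →⋆ₙₐ[ℂ] (H →L[ℂ] H)) (a : A) :
    cpCompression V π a = compression V (π a) := rfl

end

open ContinuousLinearMap in
theorem exists_isometry_of_isStarProjection {P : H →L[ℂ] H} (hP : IsStarProjection P)
    (hfin : FiniteDimensional ℂ (LinearMap.range P.toLinearMap)) :
    ∃ (d : ℕ) (V : EuclideanSpace ℂ (Fin d) →L[ℂ] H), (∀ x, ‖V x‖ = ‖x‖) ∧
      V ∘L adjoint V = P := by
  let E := LinearMap.range P.toLinearMap
  let U : EuclideanSpace ℂ (Fin (Module.finrank ℂ E)) →ₗᵢ[ℂ] H :=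
    E.subtypeₗᵢ.comp (stdOrthonormalBasis ℂ E).repr.symm.toLinearIsometry
  let V := U.toContinuousLinearMap
  have hPP : ∀ x, P (P x) = P x := fun x => congrArg (fun T : H →L[ℂ] H => T x) hP.isIdempotentElem
  have hPV : P ∘L V = V := by
    ext1 x
    obtain ⟨y, hy⟩ : V x ∈ E := ((stdOrthonormalBasis ℂ E).repr.symm x).2
    change P y = V x at hy
    rw [ContinuousLinearMap.comp_apply, ← hy, hPP]
  have hVP : adjoint V ∘L P = adjoint V := by
    have h := congrArg adjoint hPV
    rw [adjoint_comp] at h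
    rwa [show adjoint P = P from hP.isSelfAdjoint] at h
  have hVV : adjoint V ∘L V = 1 := (norm_map_iff_adjoint_comp_self V).1 U.norm_map
  refine ⟨_, V, U.norm_map, ?_⟩
  ext x
  obtain ⟨y, hy⟩ : ∃ y, V y = P x :=
    ⟨(stdOrthonormalBasis ℂ E).repr ⟨P x, x, rfl⟩, by
      change (((stdOrthonormalBasis ℂ E).repr.symm ((stdOrthonormalBasis ℂ E).repr _) : E) : H) = _
      rw [LinearIsometryEquiv.symm_apply_apply]⟩
  calc V (adjoint V x) = V ((adjoint V ∘L P) x) := by rw [hVP]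
    _ = V ((adjoint V ∘L V) y) := by
        rw [ContinuousLinearMap.comp_apply, ContinuousLinearMap.comp_apply, hy]
    _ = P x := by rw [hVV, ← hy]; rfl

open ContinuousLinearMap in
-- Take `φ = V* π(·) V` with `V V* = P`. As `P V = V`, the defect is `V* π(a) [π(b), P] V`, which is
-- controlled by the commutator.
theorem exists_cp_of_isStarProjection (π : A →⋆ₙₐ[ℂ] (H →L[ℂ] H)) {P : H →L[ℂ] H}
    (hP : IsStarProjection P) (hfin : FiniteDimensional ℂ (LinearMap.range P.toLinearMap)) :
    ∃ (d : ℕ) (φ : A →CP CStarMatrix (Fin d) (Fin d) ℂ), (∀ a, ‖φ a‖ ≤ ‖a‖) ∧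
      (∀ a b, ‖φ (a * b) - φ a * φ b‖ ≤ ‖a‖ * ‖P * π b - π b * P‖) ∧
      ∀ a v, ‖v‖ ≤ 1 → ‖P (π a (P v))‖ ≤ ‖φ a‖ := by
  obtain ⟨d, V, hV, hVP⟩ := exists_isometry_of_isStarProjection hP hfin
  have hV1 : ‖V‖ ≤ 1 := V.opNorm_le_bound zero_le_one fun x => by rw [hV, one_mul]
  have hV2 : ‖adjoint V‖ ≤ 1 := by rwa [LinearIsometryEquiv.norm_map]
  have hVV : adjoint V ∘L V = 1 := (norm_map_iff_adjoint_comp_self V).1 hV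
  have hPV : P ∘L V = V := by
    rw [← hVP, ContinuousLinearMap.comp_assoc, hVV]
    rfl
  have hle (T : H →L[ℂ] H) : ‖adjoint V ∘L T ∘L V‖ ≤ ‖T‖ :=
    calc _ ≤ ‖adjoint V‖ * (‖T‖ * ‖V‖) :=
          (opNorm_comp_le _ _).trans (mul_le_mul_of_nonneg_left (opNorm_comp_le _ _)
            (norm_nonneg _))
      _ ≤ 1 * (‖T‖ * 1) := by gcongr
      _ = ‖T‖ := by ring
  refine ⟨d, cpCompression V π, fun a => ?_, fun a b => ?_, fun a v hv => ?_⟩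
  · rw [cpCompression_apply, norm_compression]
    exact (hle _).trans (NonUnitalStarAlgHom.norm_apply_le π a)
  · rw [cpCompression_apply, cpCompression_apply, cpCompression_apply, compression_mul, ← map_sub, norm_compression, hVP]
    have e : adjoint V ∘L (π (a * b) - π a ∘L P ∘L π b) ∘L V
        = adjoint V ∘L (π a * (π b * P - P * π b)) ∘L V := by
      rw [map_mul, mul_sub]
      conv_lhs => rw [← hPV]
      conv_rhs => rw [← hPV]
      have hPP : ∀ x, P (P x) = P x :=
        fun x => congrArg (fun T : H →L[ℂ] H => T x) hP.isIdempotentElem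
      ext1 x
      simp [hPP]
    rw [e, norm_sub_rev]
    exact (hle _).trans ((norm_mul_le _ _).trans (mul_le_mul_of_nonneg_right
      (NonUnitalStarAlgHom.norm_apply_le π a) (norm_nonneg _)))
  · rw [cpCompression_apply, norm_compression]
    calc ‖P (π a (P v))‖ = ‖V ((adjoint V ∘L π a ∘L V) (adjoint V v))‖ := by rw [← hVP]; rfl
      _ = ‖(adjoint V ∘L π a ∘L V) (adjoint V v)‖ := hV _
      _ ≤ ‖adjoint V ∘L π a ∘L V‖ * ‖adjoint V v‖ := le_opNorm _ _
      _ ≤ ‖adjoint V ∘L π a ∘L V‖ * 1 := by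
          gcongr
          exact (le_opNorm _ _).trans (mul_le_one₀ hV2 (norm_nonneg _) hv)
      _ = _ := mul_one _

/-! ### From finite sets to sequences, by density. -/

theorem tendsto_of_lipschitz_of_denseRange {E ι : Type*} [SeminormedAddCommGroup E] {e : ι → E}
    (he : DenseRange e) {f : ℕ → E → ℝ} {g : E → ℝ} {C : ℝ}
    (hf : ∀ s a b, |f s a - f s b| ≤ C * ‖a - b‖) (hg : ∀ a b, |g a - g b| ≤ C * ‖a - b‖)
    (h : ∀ i, Tendsto (fun s => f s (e i)) atTop (𝓝 (g (e i)))) (a : E) :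
    Tendsto (fun s => f s a) atTop (𝓝 (g a)) := by
  rw [Metric.tendsto_nhds]
  intro ε hε
  obtain ⟨i, hi⟩ := Metric.denseRange_iff.1 he a (ε / (3 * (|C| + 1))) (by positivity)
  rw [dist_eq_norm] at hi
  have hC : C * ‖a - e i‖ < ε / 3 := by
    have h1 : ε / 3 = (|C| + 1) * (ε / (3 * (|C| + 1))) := by field_simp
    rw [h1]
    calc C * ‖a - e i‖ ≤ (|C| + 1) * ‖a - e i‖ := by
          gcongr
          linarith [le_abs_self C]
      _ < _ := by gcongr
  filter_upwards [Metric.tendsto_nhds.1 (h i) (ε / 3) (by positivity)] with s hs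
  rw [Real.dist_eq] at hs ⊢
  have h1 := hf s a (e i)
  have h2 := hg a (e i)
  rw [abs_le] at h1 h2
  rw [abs_lt] at hs ⊢
  constructor <;> linarith [hs.1, hs.2, h1.1, h1.2, h2.1, h2.2]

/-- Here `δ b = ‖[P, π b]‖`. Being Lipschitz in `b`, it allows smallness on a dense sequence to
spread to all of `A`. -/
theorem exists_cp_of_isQuasidiagonal (hA : IsQuasidiagonal A) (F : Finset A) {ε : ℝ}
    (hε : 0 < ε) :
    ∃ (d : ℕ) (φ : A →CP CStarMatrix (Fin d) (Fin d) ℂ) (δ : A → ℝ), (∀ a, ‖φ a‖ ≤ ‖a‖) ∧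
      (∀ a b, ‖φ (a * b) - φ a * φ b‖ ≤ ‖a‖ * δ b) ∧ (∀ a b, |δ a - δ b| ≤ 2 * ‖a - b‖) ∧
      (∀ a ∈ F, |δ a| ≤ ε) ∧ ∀ a ∈ F, ‖a‖ - (3 + ‖a‖) * ε ≤ ‖φ a‖ := by
  obtain ⟨H, _, _, _, π, hπ, hqd⟩ := hA
  have hiso (a : A) : ‖π a‖ = ‖a‖ := NonUnitalStarAlgHom.norm_map π hπ a
  have hv (a : A) : ∃ v : H, ‖v‖ ≤ 1 ∧ ‖a‖ - ε ≤ ‖π a v‖ := by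
    rcases eq_or_lt_of_le (norm_nonneg a) with h0 | h0
    · exact ⟨0, by simp, by rw [← h0, map_zero, norm_zero]; linarith⟩
    · obtain ⟨v, h1, h2⟩ := (π a).exists_lt_apply_of_lt_opNorm
        (show ‖a‖ - ε < ‖π a‖ by rw [hiso]; linarith)
      exact ⟨v, h1.le, h2.le⟩
  choose v hv1 hv2 using hv
  classical
  -- `P` must almost fix both the nearly norming vector `v a` and its image `π a (v a)`, so that
  -- compression almost preserves `‖a‖`.
  obtain ⟨P, hP, hfin, hcomm, hvec⟩ := hqd (F.image π) (by simp [Set.subset_def])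
    (F.image v ∪ F.image fun a => π a (v a)) ε hε
  obtain ⟨d, φ, h1, h2, h3⟩ := exists_cp_of_isStarProjection π hP hfin
  have hP1 : ‖P‖ ≤ 1 := hP.norm_le
  refine ⟨d, φ, fun b => ‖P * π b - π b * P‖, h1, h2, fun a b => ?_, fun a ha => ?_,
    fun a ha => ?_⟩
  · refine (abs_norm_sub_norm_le _ _).trans ?_
    have e : P * π a - π a * P - (P * π b - π b * P) = P * π (a - b) - π (a - b) * P := by
      rw [map_sub, mul_sub, sub_mul]; abel
    rw [e]
    calc _ ≤ ‖P‖ * ‖π (a - b)‖ + ‖π (a - b)‖ * ‖P‖ :=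
          (norm_sub_le _ _).trans (add_le_add (norm_mul_le _ _) (norm_mul_le _ _))
      _ ≤ 1 * ‖π (a - b)‖ + ‖π (a - b)‖ * 1 := by gcongr
      _ = _ := by rw [hiso]; ring
  · rw [abs_norm]
    exact hcomm _ (Finset.mem_image_of_mem _ ha)
  · have e1 : ‖P (v a) - v a‖ ≤ ε :=
      hvec _ (Finset.mem_union_left _ (Finset.mem_image_of_mem _ ha))
    have e2 : ‖P (π a (v a)) - π a (v a)‖ ≤ ε :=
      hvec _ (Finset.mem_union_right _ (Finset.mem_image_of_mem _ ha))
    have e3 : ‖P (π a (P (v a) - v a))‖ ≤ ‖a‖ * ε :=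
      calc _ ≤ ‖P‖ * (‖π a‖ * ‖P (v a) - v a‖) := (P.le_opNorm _).trans
            (mul_le_mul_of_nonneg_left ((π a).le_opNorm _) (norm_nonneg _))
        _ ≤ 1 * (‖a‖ * ε) := by rw [hiso]; gcongr
        _ = _ := one_mul _
    have e4 : π a (v a) = P (π a (P (v a))) - P (π a (P (v a) - v a))
        - (P (π a (v a)) - π a (v a)) := by
      rw [map_sub, map_sub]; abel
    have e5 : ‖π a (v a)‖ ≤ ‖P (π a (P (v a)))‖ + ‖a‖ * ε + ε := by
      conv_lhs => rw [e4]
      exact (norm_sub_le _ _).trans (add_le_add ((norm_sub_le _ _).trans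
        (add_le_add le_rfl e3)) e2)
    nlinarith [h3 a (v a) (hv1 a), hv2 a]

theorem nonempty_ccpApprox [TopologicalSpace.SeparableSpace A] (hA : IsQuasidiagonal A) :
    Nonempty (CcpApprox A) := by
  let e := TopologicalSpace.denseSeq A
  have he : DenseRange e := TopologicalSpace.denseRange_denseSeq A
  classical
  choose k φ δ h1 h2 h3 h4 h5 using fun s : ℕ =>
    exists_cp_of_isQuasidiagonal hA ((Finset.range s).image e)
      (Nat.one_div_pos_of_nat (α := ℝ) (n := s))
  have hmem (i : ℕ) : ∀ᶠ s in atTop, e i ∈ (Finset.range s).image e := by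
    filter_upwards [eventually_gt_atTop i] with s hs
    exact Finset.mem_image_of_mem _ (Finset.mem_range.2 hs)
  have hlim : Tendsto (fun s : ℕ => 1 / ((s : ℝ) + 1)) atTop (𝓝 0) :=
    tendsto_one_div_add_atTop_nhds_zero_nat
  refine ⟨⟨k, φ, h1, fun a b => ?_, fun a => ?_⟩⟩
  · have hδ : Tendsto (fun s => δ s b) atTop (𝓝 0) := by
      refine tendsto_of_lipschitz_of_denseRange he (g := fun _ => 0) (C := 2) h3
        (fun a b => by simp) (fun i => ?_) b
      refine squeeze_zero_norm' ?_ hlim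
      filter_upwards [hmem i] with s hs
      exact h4 s _ hs
    refine squeeze_zero (fun _ => norm_nonneg _) (fun s => h2 s a b) ?_
    simpa using hδ.const_mul ‖a‖
  · refine tendsto_of_lipschitz_of_denseRange he (f := fun s a => ‖φ s a‖) (g := fun a => ‖a‖)
      (C := 1) (fun s a b => ?_) (fun a b => ?_) (fun i => ?_) a
    · refine (abs_norm_sub_norm_le _ _).trans ?_
      rw [← map_sub, one_mul]
      exact h1 s _
    · rw [one_mul]
      exact abs_norm_sub_norm_le _ _
    · refine tendsto_of_tendsto_of_tendsto_of_le_of_le'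
        (g := fun s : ℕ => ‖e i‖ - (3 + ‖e i‖) * (1 / ((s : ℝ) + 1))) ?_ tendsto_const_nhds ?_
        (.of_forall fun s => h1 s _)
      · simpa using (hlim.const_mul (3 + ‖e i‖)).const_sub ‖e i‖
      · filter_upwards [hmem i] with s hs
        exact h5 s _ hs

end Compression

/-! ### The equivalence. -/

theorem proposition4p8 {A : Type*} [NonUnitalCStarAlgebra A] [PartialOrder A] [StarOrderedRing A]
    [TopologicalSpace.SeparableSpace A] (hA : IsQuasidiagonal A) :
    HasK0HahnBanach A ↔
      ∀ x : K0 A, (∀ Φ : CcpApprox A, ∀ᶠ n in atTop, 0 < Φ.pushforward x n) →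
        ∃ k : ℕ, 0 < k ∧ k • x ∈ K0Pos A := by
  obtain ⟨Φ₀⟩ := nonempty_ccpApprox hA
  constructor
  · intro h x hx
    by_contra! hk
    have hzero : (AddSubgroup.zmultiples x : Set (K0 A)) ∩ K0Pos A = {0} := by
      refine Set.eq_singleton_iff_unique_mem.2 ⟨⟨zero_mem _, zero_mem_K0Pos⟩, ?_⟩
      rintro y ⟨⟨c, rfl⟩, hc⟩
      change c • x ∈ K0Pos A at hc
      change c • x = 0
      rcases lt_trichotomy c 0 with h0 | rfl | h0
      · obtain ⟨s, ⟨h1, h2⟩, h3⟩ := (((Φ₀.eventually_pushforward_zsmul c x).and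
          (Φ₀.eventually_pushforward_nonneg hc)).and (hx Φ₀)).exists
        nlinarith
      · exact zero_smul ℤ x
      · lift c to ℕ using h0.le
        exact absurd (by simpa using hc) (hk c (by simpa using h0))
    obtain ⟨Φ, hΦ⟩ := h x hzero
    obtain ⟨s, h1, h2⟩ := (hΦ.and (hx Φ)).exists
    exact h2.ne' h1
  · intro h x hx
    -- For torsion `x` some positive multiple is `0`, which lies in the cone, so (2) could not be
    -- contradicted; any sequence works instead.
    by_cases htor : ∃ c : ℤ, c ≠ 0 ∧ c • x = 0
    · obtain ⟨c, hc0, hc⟩ := htor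
      refine ⟨Φ₀, ?_⟩
      have h1 := Φ₀.eventually_pushforward_zsmul c x
      rw [hc] at h1
      filter_upwards [h1, Φ₀.eventually_pushforward_zero] with s h1 h2
      rw [h2] at h1
      exact (mul_eq_zero.1 h1.symm).resolve_left hc0
    · push Not at htor
      have hpos (c : ℤ) (hc : c • x ∈ K0Pos A) : c = 0 := by
        by_contra h0
        exact htor c h0 (hx.subset ⟨⟨c, rfl⟩, hc⟩)
      -- Used for `ε = ±1`: failure of the conclusion of (2) for `ε • x` refutes its hypothesis.
      have key (ε : ℤ) (hε : ε ≠ 0) :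
          ∃ Φ : CcpApprox A, ∃ᶠ s in atTop, Φ.pushforward (ε • x) s ≤ 0 := by
        by_contra! hcon
        obtain ⟨k, hk, hkx⟩ := h (ε • x) fun Φ => by
          simpa [Filter.not_frequently] using hcon Φ
        rw [← natCast_zsmul, smul_smul] at hkx
        have := hpos _ hkx
        simp [hε, hk.ne'] at this
      obtain ⟨Φ, hΦ⟩ := key 1 one_ne_zero
      obtain ⟨Ψ, hΨ⟩ := key (-1) (by simp)
      rw [one_smul] at hΦ
      refine CcpApprox.exists_pushforward_eq_zero Φ Ψ hΦ
        ((hΨ.and_eventually (Ψ.eventually_pushforward_zsmul (-1) x)).mono fun s hs => ?_)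
      linarith [hs.1, hs.2]
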